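/- Let $\Omega\subset\mathbb C$ be a bounded Borel set, $\lambda$ Lebesgue measure, and let $\mathcal B$, $\mathcal C_1$, $\mathcal C_2$ be the bounded, trace-class and Hilbert--Schmidt operators on $L^2(\Omega,\lambda)$, with norms $\|\cdot\|$, $|\cdot|_1$, $|\cdot|_2$. For $f\in L^\infty(\Omega,\lambda)$ let $M_f$ be the multiplication operator by $f$ on $L^2(\Omega,\lambda)$, let $Z$ be multiplication by the coordinate function $z\mapsto z$, and let $Df(s,t)=\frac{f(s)-f(t)}{s-t}$ for $s\neq t$. Let $\Lambda(\Omega)=\{f\in L^\infty(\Omega,\lambda) : Df\in L^\infty(\Omega\times\Omega,\lambda\otimes\lambda)\}$ and, for $T\in\mathcal B$, $$L(T)=\sup\{|[M_f,T]|_2 : f\in\Lambda(\Omega),\ \|Df\|_\infty\le 1\}\in[0,\infty].$$ Let $E\Lambda(\Omega)=\{T\in\mathcal B : L(T)<\infty\}$, with the norm $\|T\|+L(T)$, and let $\mathcal K\Lambda(\Omega)$ be the subspace of compact operators in $E\Lambda(\Omega)$, with the same norm. Give $\mathcal C_1\times\mathcal C_2$ the norm $\max(|x|_1,|y|_2)$,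 let $$\mathcal N=\{([Z,H],H) : H\in\mathcal C_2,\ [Z,H]\in\mathcal C_1\},$$ and give $(\mathcal C_1\times\mathcal C_2)/\mathcal N$ the quotient norm. Then, for all $T\in E\Lambda(\Omega)$, $x\in\mathcal C_1$ and $y\in\mathcal C_2$, the operator $Tx+[Z,T]y$ is of trace class, and the pairing $$\langle T,(x,y)\rangle=\operatorname{Tr}(Tx+[Z,T]y)$$ induces an isometric linear isomorphism $\Phi$ of $E\Lambda(\Omega)$ onto the dual of $(\mathcal C_1\times\mathcal C_2)/\mathcal N$. Hence $E\Lambda(\Omega)$ is the bidual of $\mathcal K\Lambda(\Omega)$: the same pairing, restricted to $T\in\mathcal K\Lambda(\Omega)$, induces an isometric linear isomorphism $\Psi$ of $(\mathcal C_1\times\mathcal C_2)/\mathcal N$ onto the dual of $\mathcal K\Lambda(\Omega)$, and there is an isometric linear isomorphism $\Theta$ of $E\Lambda(\Omega)$ onto the bidual of $\mathcal K\Lambda(\Omega)$ with $\Theta(T)(\Psi(q))=\Phi(T)(q)$ for all $T\in E\Lambda(\Omega)$, $q\in(\mathcal C_1\times\mathcal C_2)/\mathcal N$, whose restriction to $\mathcal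 K\Lambda(\Omega)$ is the canonical embedding of $\mathcal K\Lambda(\Omega)$ into its bidual. -/

import Mathlib

open MeasureTheory
open scoped ENNReal InnerProductSpace

set_option maxSynthPendingDepth 3

noncomputable section

namespace AlmostNormal

/-! ## Normed spaces cut out by an extended norm -/

/-- A norm on a complex vector space that is allowed to take the value `∞`. -/
structure ExtNorm (E : Type*) [AddCommGroup E] [Module ℂ E] where
  toFun : E → ℝ≥0∞
  add_le : ∀ x y, toFun (x + y) ≤ toFun x + toFun y
  smul : ∀ (c : ℂ) x, toFun (c • x) = ‖c‖ₑ * toFun x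
  eq_zero : ∀ x, toFun x = 0 → x = 0

namespace ExtNorm

variable {E : Type*} [AddCommGroup E] [Module ℂ E] (n : ExtNorm E)

lemma map_zero : n.toFun 0 = 0 := by
  have h := n.smul 0 0
  simpa using h

/-- The linear subspace of vectors of finite norm. -/
def finite : Submodule ℂ E where
  carrier := {x | n.toFun x < ∞}
  zero_mem' := by simp [n.map_zero]
  add_mem' := fun hx hy => (n.add_le _ _).trans_lt (ENNReal.add_lt_top.2 ⟨hx, hy⟩)
  smul_mem' := fun c x hx => by
    change n.toFun (c • x) < ∞
    rw [n.smul]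
    exact ENNReal.mul_lt_top enorm_lt_top hx

/-- The norm, on the subspace of vectors of finite norm. -/
abbrev finiteNorm : Norm n.finite := ⟨fun x => (n.toFun x).toReal⟩

lemma finiteCore : @NormedSpace.Core ℂ n.finite _ _ _ n.finiteNorm :=
  letI := n.finiteNorm
  { norm_nonneg := fun _ => ENNReal.toReal_nonneg
    norm_smul := fun c x => by
      change (n.toFun (c • (x : E))).toReal = ‖c‖ * (n.toFun x).toReal
      rw [n.smul, ENNReal.toReal_mul, toReal_enorm]
    norm_triangle := fun x y => by
      change (n.toFun (x + y : E)).toReal ≤ (n.toFun x).toReal + (n.toFun y).toReal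
      have hx : n.toFun x ≠ ∞ := ne_of_lt x.2
      have hy : n.toFun y ≠ ∞ := ne_of_lt y.2
      rw [← ENNReal.toReal_add hx hy]
      exact ENNReal.toReal_mono (ENNReal.add_ne_top.2 ⟨hx, hy⟩) (n.add_le _ _)
    norm_eq_zero_iff := fun x => by
      change (n.toFun x).toReal = 0 ↔ x = 0
      rw [ENNReal.toReal_eq_zero_iff]
      constructor
      · rintro (h | h)
        · exact Subtype.ext (n.eq_zero _ h)
        · exact absurd h (ne_of_lt x.2)
      · rintro rfl
        exact Or.inl n.map_zero }

/-- The vectors of finite norm, as a type of its own; it carries the norm `n`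
and no other one. -/
def Space : Type _ := ↥n.finite

instance : NormedAddCommGroup n.Space :=
  @NormedAddCommGroup.ofCore ℂ n.finite _ _ _ n.finiteNorm n.finiteCore

instance : NormedSpace ℂ n.Space :=
  @NormedSpace.ofCore ℂ n.finite _
    (@NormedAddCommGroup.ofCore ℂ n.finite _ _ _ n.finiteNorm n.finiteCore).toSeminormedAddCommGroup
    _ n.finiteCore

/-- The inclusion of the vectors of finite norm into the ambient space. -/
def incl : n.Space →ₗ[ℂ] E where
  toFun x := x.1
  map_add' _ _ := rfl
  map_smul' _ _ := rfl

lemma incl_lt_top (x : n.Space) : n.toFun (n.incl x) < ∞ := x.2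

lemma incl_injective : Function.Injective n.incl := Subtype.val_injective

lemma norm_def (x : n.Space) : ‖x‖ = (n.toFun (n.incl x)).toReal := rfl

end ExtNorm

/-! ## The Hilbert–Schmidt class -/

section Schatten

set_option linter.unusedSectionVars false

variable (H : Type*) [NormedAddCommGroup H] [InnerProductSpace ℂ H] [CompleteSpace H]

/-- The index set of a fixed orthonormal basis of `H`. -/
def basisIndex : Set H := (exists_hilbertBasis ℂ H).choose

/-- A fixed orthonormal basis of `H`. -/
def basis : HilbertBasis (basisIndex H) ℂ H := (exists_hilbertBasis ℂ H).choose_spec.choose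

variable {H}

/-- `∑ᵢ ‖T eᵢ‖² = Tr (T* T)` for an orthonormal basis `(eᵢ)`. -/
def hsSum {ι : Type*} (b : HilbertBasis ι ℂ H) (T : H →L[ℂ] H) : ℝ≥0∞ :=
  ∑' i, ‖T (b i)‖ₑ ^ 2

lemma parseval {ι : Type*} (b : HilbertBasis ι ℂ H) (x : H) :
    ∑' i, ‖⟪b i, x⟫_ℂ‖ₑ ^ 2 = ‖x‖ₑ ^ 2 := by
  have h := b.hasSum_inner_mul_inner x x
  have h2 : HasSum (fun i => ‖⟪b i, x⟫_ℂ‖ ^ 2) (‖x‖ ^ 2) := by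
    have h3 := Complex.hasSum_re h
    have e : (⟪x, x⟫_ℂ).re = ‖x‖ ^ 2 := by
      rw [inner_self_eq_norm_sq_to_K]
      norm_cast
    rw [e] at h3
    convert h3 using 2 with i
    rw [← inner_conj_symm x (b i), ← Complex.normSq_eq_conj_mul_self, Complex.ofReal_re,
      Complex.normSq_eq_norm_sq]
  have h4 := ENNReal.ofReal_tsum_of_nonneg (fun i => sq_nonneg ‖⟪b i, x⟫_ℂ‖) h2.summable
  rw [h2.tsum_eq] at h4
  simp_rw [ENNReal.ofReal_pow (norm_nonneg _), ofReal_norm] at h4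
  exact h4.symm

lemma hsSum_adjoint {ι κ : Type*} (b : HilbertBasis ι ℂ H) (c : HilbertBasis κ ℂ H)
    (T : H →L[ℂ] H) : hsSum b T = hsSum c (star T) := by
  unfold hsSum
  calc ∑' i, ‖T (b i)‖ₑ ^ 2 = ∑' i, ∑' j, ‖⟪c j, T (b i)⟫_ℂ‖ₑ ^ 2 := by
        simp_rw [parseval c]
    _ = ∑' j, ∑' i, ‖⟪c j, T (b i)⟫_ℂ‖ₑ ^ 2 := ENNReal.tsum_comm
    _ = ∑' j, ∑' i, ‖⟪b i, (star T) (c j)⟫_ℂ‖ₑ ^ 2 := by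
        refine tsum_congr fun j => tsum_congr fun i => ?_
        rw [ContinuousLinearMap.star_eq_adjoint, ContinuousLinearMap.adjoint_inner_right,
          ← inner_conj_symm, ← ofReal_norm, ← ofReal_norm, RCLike.norm_conj]
    _ = ∑' j, ‖(star T) (c j)‖ₑ ^ 2 := by simp_rw [parseval b]

lemma hsSum_indep {ι κ : Type*} (b : HilbertBasis ι ℂ H) (c : HilbertBasis κ ℂ H)
    (T : H →L[ℂ] H) : hsSum b T = hsSum c T := by
  rw [hsSum_adjoint b b T, hsSum_adjoint b c (star T), star_star]

lemma hsSum_comp_left_le {ι : Type*} (b : HilbertBasis ι ℂ H) (A T : H →L[ℂ] H)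
    (hA : ‖A‖ ≤ 1) : hsSum b (A * T) ≤ hsSum b T := by
  refine ENNReal.tsum_le_tsum fun i => ?_
  gcongr
  rw [← ofReal_norm, ← ofReal_norm]
  refine ENNReal.ofReal_le_ofReal ?_
  calc ‖A (T (b i))‖ ≤ ‖A‖ * ‖T (b i)‖ := A.le_opNorm _
    _ ≤ 1 * ‖T (b i)‖ := by gcongr
    _ = ‖T (b i)‖ := one_mul _

lemma hsSum_comp_right_le {ι : Type*} (b : HilbertBasis ι ℂ H) (A T : H →L[ℂ] H)
    (hA : ‖A‖ ≤ 1) : hsSum b (T * A) ≤ hsSum b T := by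
  rw [hsSum_adjoint b b (T * A), hsSum_adjoint b b T, star_mul]
  exact hsSum_comp_left_le b _ _ (by rwa [norm_star])

/-- The Hilbert–Schmidt norm `|T|₂ = (Tr (T* T))^{1/2}`, equal to `∞` if `T` is not
Hilbert–Schmidt. -/
def hsNorm (T : H →L[ℂ] H) : ℝ≥0∞ := hsSum (basis H) T ^ (1 / 2 : ℝ)

lemma hsSum_eq_zero {ι : Type*} (b : HilbertBasis ι ℂ H) (T : H →L[ℂ] H)
    (h : hsSum b T = 0) : T = 0 := by
  unfold hsSum at h
  rw [ENNReal.tsum_eq_zero] at h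
  refine ContinuousLinearMap.ext_on (s := Set.range b) ?_ ?_
  · have := b.dense_span
    exact (Submodule.dense_iff_topologicalClosure_eq_top).2 this
  · rintro _ ⟨i, rfl⟩
    simpa using h i

lemma hsNorm_add_le (S T : H →L[ℂ] H) : hsNorm (S + T) ≤ hsNorm S + hsNorm T := by
  let : MeasurableSpace (basisIndex H) := ⊤
  have h := ENNReal.lintegral_Lp_add_le (μ := (Measure.count : Measure (basisIndex H))) (p := 2)
    (f := fun i => ‖S (basis H i)‖ₑ) (g := fun i => ‖T (basis H i)‖ₑ)
    (measurable_from_top).aemeasurable (measurable_from_top).aemeasurable (by norm_num)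
  simp only [lintegral_count, Pi.add_apply, ENNReal.rpow_ofNat] at h
  refine le_trans ?_ h
  unfold hsNorm hsSum
  gcongr
  exact enorm_add_le _ _

lemma hsNorm_smul (c : ℂ) (T : H →L[ℂ] H) : hsNorm (c • T) = ‖c‖ₑ * hsNorm T := by
  unfold hsNorm hsSum
  have : ∀ i, ‖(c • T) (basis H i)‖ₑ ^ 2 = ‖c‖ₑ ^ 2 * ‖T (basis H i)‖ₑ ^ 2 := fun i => by
    rw [smul_apply, enorm_smul, mul_pow]
  simp_rw [this]
  rw [ENNReal.tsum_mul_left, ENNReal.mul_rpow_of_nonneg _ _ (by norm_num)]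
  congr 1
  rw [← ENNReal.rpow_natCast, ← ENNReal.rpow_mul]
  norm_num

lemma hsNorm_eq_zero (T : H →L[ℂ] H) (h : hsNorm T = 0) : T = 0 := by
  unfold hsNorm at h
  rw [ENNReal.rpow_eq_zero_iff_of_pos (by norm_num)] at h
  exact hsSum_eq_zero _ T h

variable (H) in
/-- The Hilbert–Schmidt norm on `B(H)`, as an extended norm. -/
def hsExtNorm : ExtNorm (H →L[ℂ] H) where
  toFun := hsNorm
  add_le := hsNorm_add_le
  smul := hsNorm_smul
  eq_zero := hsNorm_eq_zero

variable (H) in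
/-- The Hilbert–Schmidt class `C₂(H)` with the norm `|·|₂`. -/
abbrev C₂ : Type _ := (hsExtNorm H).Space

/-- The commutator `[A, B] = A B - B A`. -/
def comm (A B : H →L[ℂ] H) : H →L[ℂ] H := A * B - B * A

lemma comm_add (A B C : H →L[ℂ] H) : comm A (B + C) = comm A B + comm A C := by
  unfold comm
  noncomm_ring

lemma comm_smul (c : ℂ) (A B : H →L[ℂ] H) : comm A (c • B) = c • comm A B := by
  unfold comm
  rw [smul_sub, mul_smul_comm, smul_mul_assoc]

/-! ## The trace class -/

/-- The trace norm `|T|₁ = Tr |T| = ∑ᵢ ⟨eᵢ, |T| eᵢ⟩`, `|T| = (T* T)^{1/2}`, equal to `∞` if `T`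
is not of trace class. -/
def traceNorm (T : H →L[ℂ] H) : ℝ≥0∞ :=
  ∑' i, ENNReal.ofReal (⟪basis H i, CFC.abs T (basis H i)⟫_ℂ).re

/-- The trace of an operator (of trace class). -/
def trace (T : H →L[ℂ] H) : ℂ := ∑' i, ⟪basis H i, T (basis H i)⟫_ℂ

/-- The positive square root of `|T|`. -/
def sqrtAbs (T : H →L[ℂ] H) : H →L[ℂ] H := CFC.sqrt (CFC.abs T)

lemma sqrtAbs_mul (T : H →L[ℂ] H) : sqrtAbs T * sqrtAbs T = CFC.abs T :=
  CFC.sqrt_mul_sqrt_self _ (CFC.abs_nonneg T)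

lemma star_sqrtAbs (T : H →L[ℂ] H) : star (sqrtAbs T) = sqrtAbs T :=
  (IsSelfAdjoint.of_nonneg (CFC.sqrt_nonneg _)).star_eq

lemma inner_sqrtAbs (T : H →L[ℂ] H) (x y : H) :
    ⟪x, sqrtAbs T y⟫_ℂ = ⟪sqrtAbs T x, y⟫_ℂ := by
  conv_lhs => rw [← star_sqrtAbs, ContinuousLinearMap.star_eq_adjoint]
  rw [ContinuousLinearMap.adjoint_inner_right]

lemma inner_abs (T : H →L[ℂ] H) (x : H) :
    ⟪x, CFC.abs T x⟫_ℂ = ((‖sqrtAbs T x‖ ^ 2 : ℝ) : ℂ) := by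
  rw [← sqrtAbs_mul, mul_apply_eq_comp, inner_sqrtAbs, inner_self_eq_norm_sq_to_K]
  norm_cast

lemma traceNorm_eq_hsSum {ι : Type*} (b : HilbertBasis ι ℂ H) (T : H →L[ℂ] H) :
    traceNorm T = hsSum b (sqrtAbs T) := by
  rw [hsSum_indep b (basis H)]
  unfold traceNorm hsSum
  refine tsum_congr fun i => ?_
  rw [inner_abs, Complex.ofReal_re, ENNReal.ofReal_pow (norm_nonneg _), ofReal_norm]

lemma norm_abs_apply (T : H →L[ℂ] H) (x : H) : ‖CFC.abs T x‖ = ‖T x‖ := by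
  have h : ⟪CFC.abs T x, CFC.abs T x⟫_ℂ = ⟪T x, T x⟫_ℂ := by
    have hs : star (CFC.abs T) = CFC.abs T :=
      (IsSelfAdjoint.of_nonneg (CFC.abs_nonneg T)).star_eq
    calc ⟪CFC.abs T x, CFC.abs T x⟫_ℂ = ⟪x, (star (CFC.abs T) * CFC.abs T) x⟫_ℂ := by
          rw [mul_apply_eq_comp, ContinuousLinearMap.star_eq_adjoint,
            ContinuousLinearMap.adjoint_inner_right]
      _ = ⟪x, (star T * T) x⟫_ℂ := by rw [hs, CFC.abs_mul_abs]
      _ = ⟪T x, T x⟫_ℂ := by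
          rw [mul_apply_eq_comp, ContinuousLinearMap.star_eq_adjoint,
            ContinuousLinearMap.adjoint_inner_right]
  rw [inner_self_eq_norm_sq_to_K, inner_self_eq_norm_sq_to_K] at h
  have h2 : ‖CFC.abs T x‖ ^ 2 = ‖T x‖ ^ 2 := by exact_mod_cast h
  exact (sq_eq_sq₀ (norm_nonneg _) (norm_nonneg _)).1 h2

/-- The polar decomposition. -/
lemma exists_polar (T : H →L[ℂ] H) :
    ∃ W : H →L[ℂ] H, ‖W‖ ≤ 1 ∧ T = W * CFC.abs T ∧ CFC.abs T = star W * T := by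
  let P : H →L[ℂ] H := CFC.abs T
  let K : Submodule ℂ H := (LinearMap.range P.toLinearMap).topologicalClosure
  have : CompleteSpace K := (Submodule.isClosed_topologicalClosure _).completeSpace_coe
  let e : H →ₗ[ℂ] K := LinearMap.codRestrict K P.toLinearMap
    (fun x => Submodule.le_topologicalClosure _ (LinearMap.mem_range_self _ x))
  have he : DenseRange e := by
    intro y
    rw [closure_subtype]
    have hy : (y : H) ∈ closure ((LinearMap.range P.toLinearMap : Submodule ℂ H) : Set H) := y.2
    refine closure_mono ?_ hy
    rintro _ ⟨x, rfl⟩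
    exact ⟨e x, ⟨x, rfl⟩, rfl⟩
  have hb : ∀ x, ‖T.toLinearMap x‖ ≤ 1 * ‖e x‖ := fun x => by
    rw [one_mul]
    exact (norm_abs_apply T x).ge
  let V : K →L[ℂ] H := T.toLinearMap.extendOfNorm e
  have hV : ‖V‖ ≤ 1 := LinearMap.opNorm_extendOfNorm_le he zero_le_one hb
  have hVe : ∀ x, V (e x) = T x := fun x => LinearMap.extendOfNorm_eq he ⟨1, hb⟩ x
  let W : H →L[ℂ] H := V ∘L K.orthogonalProjectionOnto
  have hW : ‖W‖ ≤ 1 := by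
    refine (ContinuousLinearMap.opNorm_comp_le _ _).trans ?_
    exact mul_le_one₀ hV (norm_nonneg _) K.orthogonalProjectionOnto_norm_le
  have hWP : ∀ x, W (P x) = T x := fun x => by
    have : K.orthogonalProjectionOnto (P x) = e x :=
      K.orthogonalProjectionOnto_mem_subspace_eq_self (e x)
    change V (K.orthogonalProjectionOnto (P x)) = T x
    rw [this, hVe]
  refine ⟨W, hW, ?_, ?_⟩
  · ext x
    exact (hWP x).symm
  · ext x
    have hn : ‖(star W) (T x)‖ ≤ ‖P x‖ := by
      calc ‖(star W) (T x)‖ ≤ ‖star W‖ * ‖T x‖ := (star W).le_opNorm _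
        _ ≤ 1 * ‖T x‖ := by gcongr; rwa [norm_star]
        _ = ‖P x‖ := by rw [one_mul, norm_abs_apply]
    have hi : RCLike.re ⟪P x, (star W) (T x)⟫_ℂ = ‖P x‖ ^ 2 := by
      rw [ContinuousLinearMap.star_eq_adjoint, ContinuousLinearMap.adjoint_inner_right, hWP,
        inner_self_eq_norm_sq_to_K, norm_abs_apply]
      norm_cast
    have hd : ‖P x - (star W) (T x)‖ ^ 2 ≤ 0 := by
      rw [@norm_sub_sq ℂ, hi]
      nlinarith [norm_nonneg ((star W) (T x)), norm_nonneg (P x)]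
    have hd0 : ‖P x - (star W) (T x)‖ = 0 := by
      nlinarith [norm_nonneg (P x - (star W) (T x))]
    exact sub_eq_zero.1 (norm_eq_zero.1 hd0)

lemma two_mul_enorm_inner_le (u v : H) : 2 * ‖⟪u, v⟫_ℂ‖ₑ ≤ ‖u‖ₑ ^ 2 + ‖v‖ₑ ^ 2 := by
  have h : 2 * ‖⟪u, v⟫_ℂ‖ ≤ ‖u‖ ^ 2 + ‖v‖ ^ 2 := by
    nlinarith [norm_inner_le_norm (𝕜 := ℂ) u v, sq_nonneg (‖u‖ - ‖v‖)]
  have h2 := ENNReal.ofReal_le_ofReal h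
  rw [ENNReal.ofReal_add (by positivity) (by positivity), ENNReal.ofReal_mul (by norm_num),
    ENNReal.ofReal_pow (norm_nonneg _), ENNReal.ofReal_pow (norm_nonneg _), ofReal_norm,
    ofReal_norm, ofReal_norm] at h2
  simpa using h2

lemma tsum_enorm_inner_le {ι : Type*} (b : HilbertBasis ι ℂ H) (V T : H →L[ℂ] H)
    (hV : ‖V‖ ≤ 1) : ∑' i, ‖⟪V (b i), T (b i)⟫_ℂ‖ₑ ≤ traceNorm T := by
  obtain ⟨W, hW, hT, -⟩ := exists_polar T
  let C : H →L[ℂ] H := sqrtAbs T * (star W * V)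
  have hC : hsSum b C ≤ traceNorm T := by
    rw [traceNorm_eq_hsSum b]
    refine hsSum_comp_right_le b _ _ ((norm_mul_le _ _).trans ?_)
    exact mul_le_one₀ (by rwa [norm_star]) (norm_nonneg _) hV
  have hi : ∀ i, ⟪V (b i), T (b i)⟫_ℂ = ⟪C (b i), sqrtAbs T (b i)⟫_ℂ := fun i => by
    conv_lhs => rw [hT, ← sqrtAbs_mul]
    change ⟪V (b i), W (sqrtAbs T (sqrtAbs T (b i)))⟫_ℂ
      = ⟪sqrtAbs T ((star W) (V (b i))), sqrtAbs T (b i)⟫_ℂ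
    rw [← inner_sqrtAbs T ((star W) (V (b i))), ContinuousLinearMap.star_eq_adjoint,
      ContinuousLinearMap.adjoint_inner_left]
  have h2 : 2 * ∑' i, ‖⟪V (b i), T (b i)⟫_ℂ‖ₑ ≤ 2 * traceNorm T := by
    rw [← ENNReal.tsum_mul_left]
    calc ∑' i, 2 * ‖⟪V (b i), T (b i)⟫_ℂ‖ₑ
        ≤ ∑' i, (‖C (b i)‖ₑ ^ 2 + ‖sqrtAbs T (b i)‖ₑ ^ 2) :=
          ENNReal.tsum_le_tsum fun i => by rw [hi]; exact two_mul_enorm_inner_le _ _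
      _ = hsSum b C + hsSum b (sqrtAbs T) := ENNReal.tsum_add
      _ ≤ traceNorm T + traceNorm T := by
          gcongr
          rw [traceNorm_eq_hsSum b]
      _ = 2 * traceNorm T := (two_mul _).symm
  exact (ENNReal.mul_le_mul_iff_right (by norm_num) (by norm_num)).1 h2

lemma traceNorm_add_le (S T : H →L[ℂ] H) : traceNorm (S + T) ≤ traceNorm S + traceNorm T := by
  obtain ⟨W, hW, -, hA⟩ := exists_polar (S + T)
  calc traceNorm (S + T)
      ≤ ∑' i, (‖⟪W (basis H i), S (basis H i)⟫_ℂ‖ₑ + ‖⟪W (basis H i), T (basis H i)⟫_ℂ‖ₑ) := by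
        refine ENNReal.tsum_le_tsum fun i => ?_
        rw [hA, mul_apply_eq_comp, ContinuousLinearMap.star_eq_adjoint,
          ContinuousLinearMap.adjoint_inner_right, add_apply, inner_add_right]
        refine le_trans ?_ (enorm_add_le _ _)
        rw [← ofReal_norm]
        exact ENNReal.ofReal_le_ofReal (Complex.re_le_norm _)
    _ = _ := ENNReal.tsum_add
    _ ≤ traceNorm S + traceNorm T :=
        add_le_add (tsum_enorm_inner_le _ _ _ hW) (tsum_enorm_inner_le _ _ _ hW)

lemma traceNorm_smul (c : ℂ) (T : H →L[ℂ] H) : traceNorm (c • T) = ‖c‖ₑ * traceNorm T := by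
  unfold traceNorm
  rw [← ENNReal.tsum_mul_left]
  refine tsum_congr fun i => ?_
  have h : (⟪basis H i, CFC.abs (c • T) (basis H i)⟫_ℂ).re
      = ‖c‖ * (⟪basis H i, CFC.abs T (basis H i)⟫_ℂ).re := by
    rw [CFC.abs_smul, smul_apply, inner_smul_right_eq_smul, Complex.smul_re,
      smul_eq_mul]
  rw [h, ENNReal.ofReal_mul (norm_nonneg _), ofReal_norm]

lemma traceNorm_eq_zero (T : H →L[ℂ] H) (h : traceNorm T = 0) : T = 0 := by
  rw [traceNorm_eq_hsSum (basis H)] at h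
  have h2 := sqrtAbs_mul T
  rw [hsSum_eq_zero _ _ h, zero_mul] at h2
  ext x
  rw [zero_apply, ← norm_eq_zero, ← norm_abs_apply, ← h2]
  simp

lemma hasSum_norm_sq {ι : Type*} (b : HilbertBasis ι ℂ H) (T : H →L[ℂ] H)
    (hT : hsSum (basis H) T ≠ ∞) :
    HasSum (fun i => ‖T (b i)‖ ^ 2) (hsSum (basis H) T).toReal := by
  rw [hsSum_indep (basis H) b] at hT ⊢
  have h := ENNReal.hasSum_toReal (f := fun i => ‖T (b i)‖ₑ ^ 2) hT
  have e : (hsSum b T).toReal = ∑' i, (‖T (b i)‖ₑ ^ 2).toReal :=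
    ENNReal.tsum_toReal_eq (fun i => ENNReal.ne_top_of_tsum_ne_top hT i)
  rw [e]
  simpa using h

/-- The trace of a trace-class operator is the sum of its diagonal in any orthonormal basis. -/
theorem hasSum_trace {ι : Type*} (b : HilbertBasis ι ℂ H) (T : H →L[ℂ] H)
    (hT : traceNorm T < ∞) : HasSum (fun i => ⟪b i, T (b i)⟫_ℂ) (trace T) := by
  obtain ⟨W, hW, hTW, -⟩ := exists_polar T
  let C : H →L[ℂ] H := sqrtAbs T * star W
  let D : H →L[ℂ] H := sqrtAbs T
  have hD : D ∈ (hsExtNorm H).finite := by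
    rw [traceNorm_eq_hsSum (basis H)] at hT
    exact ENNReal.rpow_lt_top_of_nonneg (by norm_num) hT.ne
  have hC : C ∈ (hsExtNorm H).finite := by
    rw [traceNorm_eq_hsSum (basis H)] at hT
    exact ENNReal.rpow_lt_top_of_nonneg (by norm_num)
      ((hsSum_comp_right_le (basis H) _ _ (by rwa [norm_star])).trans_lt hT).ne
  have hi : ∀ x, ⟪x, T x⟫_ℂ = ⟪C x, D x⟫_ℂ := fun x => by
    conv_lhs => rw [hTW, ← sqrtAbs_mul]
    change ⟪x, W (sqrtAbs T (sqrtAbs T x))⟫_ℂ = ⟪sqrtAbs T ((star W) x), sqrtAbs T x⟫_ℂ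
    rw [← inner_sqrtAbs T ((star W) x), ContinuousLinearMap.star_eq_adjoint,
      ContinuousLinearMap.adjoint_inner_left]
  have hs : ∀ R ∈ (hsExtNorm H).finite, hsSum (basis H) R ≠ ∞ := fun R hR h => by
    have h2 : hsSum (basis H) R ^ (1 / 2 : ℝ) < ∞ := hR
    rw [h, ENNReal.top_rpow_of_pos (by norm_num)] at h2
    exact lt_irrefl _ h2
  have h1 := hasSum_norm_sq b (C + D) (hs _ (Submodule.add_mem _ hC hD))
  have h2 := hasSum_norm_sq b (C - D) (hs _ (Submodule.sub_mem _ hC hD))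
  have h3 := hasSum_norm_sq b (C - Complex.I • D)
    (hs _ (Submodule.sub_mem _ hC (Submodule.smul_mem _ _ hD)))
  have h4 := hasSum_norm_sq b (C + Complex.I • D)
    (hs _ (Submodule.add_mem _ hC (Submodule.smul_mem _ _ hD)))
  have g1 := hasSum_norm_sq (basis H) (C + D) (hs _ (Submodule.add_mem _ hC hD))
  have g2 := hasSum_norm_sq (basis H) (C - D) (hs _ (Submodule.sub_mem _ hC hD))
  have g3 := hasSum_norm_sq (basis H) (C - Complex.I • D)
    (hs _ (Submodule.sub_mem _ hC (Submodule.smul_mem _ _ hD)))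
  have g4 := hasSum_norm_sq (basis H) (C + Complex.I • D)
    (hs _ (Submodule.add_mem _ hC (Submodule.smul_mem _ _ hD)))
  have hb := (((Complex.hasSum_ofReal.2 h1).sub (Complex.hasSum_ofReal.2 h2)).add
    (((Complex.hasSum_ofReal.2 h3).sub (Complex.hasSum_ofReal.2 h4)).mul_right
      Complex.I)).div_const 4
  have gb := (((Complex.hasSum_ofReal.2 g1).sub (Complex.hasSum_ofReal.2 g2)).add
    (((Complex.hasSum_ofReal.2 g3).sub (Complex.hasSum_ofReal.2 g4)).mul_right
      Complex.I)).div_const 4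
  have hp : ∀ x, ⟪x, T x⟫_ℂ = ((((‖(C + D) x‖ ^ 2 : ℝ) : ℂ) - ((‖(C - D) x‖ ^ 2 : ℝ) : ℂ)) +
      (((‖(C - Complex.I • D) x‖ ^ 2 : ℝ) : ℂ) - ((‖(C + Complex.I • D) x‖ ^ 2 : ℝ) : ℂ))
        * Complex.I) / 4 := fun x => by
    rw [hi, inner_eq_sum_norm_sq_div_four]
    push_cast
    rfl
  unfold trace
  simp_rw [hp]
  rw [gb.tsum_eq]
  exact hb

variable (H) in
/-- The trace norm on `B(H)`, as an extended norm. -/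
def traceExtNorm : ExtNorm (H →L[ℂ] H) where
  toFun := traceNorm
  add_le := traceNorm_add_le
  smul := traceNorm_smul
  eq_zero := traceNorm_eq_zero

variable (H) in
/-- The trace class `C₁(H)` with the norm `|·|₁`. -/
abbrev C₁ : Type _ := (traceExtNorm H).Space

/-- The subspace `N = {([Z, h], h) ∈ C₁ × C₂}` of `C₁ × C₂`. The product carries the norm
`max (|x|₁, |y|₂)`. -/
def nullPairs (Z : H →L[ℂ] H) : Submodule ℂ (C₁ H × C₂ H) where
  carrier := {p | (traceExtNorm H).incl p.1 = comm Z ((hsExtNorm H).incl p.2)}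
  zero_mem' := by simp [comm]
  add_mem' := fun {p q} hp hq => by
    simp only [Set.mem_ofPred_eq] at hp hq ⊢
    rw [Prod.fst_add, Prod.snd_add, map_add, map_add, comm_add, hp, hq]
  smul_mem' := fun c p hp => by
    simp only [Set.mem_ofPred_eq] at hp ⊢
    rw [Prod.smul_fst, Prod.smul_snd, map_smul, map_smul, hp, comm_smul]

end Schatten

/-! ## The algebras `EΛ(Ω)` and `KΛ(Ω)` -/

section Lambda

variable (Ω : Set ℂ)

/-- Lebesgue measure on `Ω`. -/
abbrev leb : Measure ℂ := volume.restrict Ω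

/-- The Hilbert space `L²(Ω, λ)`. -/
abbrev L2 : Type := Lp ℂ 2 (leb Ω)

variable {Ω}

/-- The multiplication operator `M_f` on `L²(Ω, λ)`, for `f ∈ L^∞(Ω, λ)`. -/
def mulOp (f : Lp ℂ ∞ (leb Ω)) : L2 Ω →L[ℂ] L2 Ω :=
  (ContinuousLinearMap.mul ℂ ℂ).holderL (leb Ω) ∞ 2 2 f

/-- The difference quotient `Df(s, t) = (f(s) - f(t)) / (s - t)` (given the value `0` on the
diagonal, which is a null set). -/
def diffQuot (f : ℂ → ℂ) (p : ℂ × ℂ) : ℂ := (f p.1 - f p.2) / (p.1 - p.2)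

/-- `‖Df‖_∞`, with respect to `λ ⊗ λ` on `Ω × Ω`. -/
def lipNorm (f : Lp ℂ ∞ (leb Ω)) : ℝ≥0∞ := eLpNorm (diffQuot f) ∞ ((leb Ω).prod (leb Ω))

variable (Ω) in
/-- The essentially Lipschitz functions `Λ(Ω)`. -/
def Lam : Set (Lp ℂ ∞ (leb Ω)) := {f | MemLp (diffQuot f) ∞ ((leb Ω).prod (leb Ω))}

/-- `L(T) = sup {|[M_f, T]|₂ : f ∈ Λ(Ω), ‖Df‖_∞ ≤ 1}`. -/
def lipConst (T : L2 Ω →L[ℂ] L2 Ω) : ℝ≥0∞ :=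
  ⨆ f ∈ {f : Lp ℂ ∞ (leb Ω) | f ∈ Lam Ω ∧ lipNorm f ≤ 1}, hsNorm (comm (mulOp f) T)

lemma lipConst_add_le (S T : L2 Ω →L[ℂ] L2 Ω) :
    lipConst (S + T) ≤ lipConst S + lipConst T := by
  refine iSup₂_le fun f hf => ?_
  rw [comm_add]
  exact (hsNorm_add_le _ _).trans (add_le_add
    (le_iSup₂ (f := fun f _ => hsNorm (comm (mulOp f) S)) f hf)
    (le_iSup₂ (f := fun f _ => hsNorm (comm (mulOp f) T)) f hf))

lemma lipConst_smul (c : ℂ) (T : L2 Ω →L[ℂ] L2 Ω) :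
    lipConst (c • T) = ‖c‖ₑ * lipConst T := by
  unfold lipConst
  simp_rw [ENNReal.mul_iSup]
  refine iSup_congr fun f => iSup_congr fun hf => ?_
  rw [← hsNorm_smul, comm_smul]

lemma opENorm_add_le (S T : L2 Ω →L[ℂ] L2 Ω) : ‖S + T‖ₑ ≤ ‖S‖ₑ + ‖T‖ₑ := by
  rw [← ofReal_norm, ← ofReal_norm, ← ofReal_norm,
    ← ENNReal.ofReal_add (norm_nonneg _) (norm_nonneg _)]
  exact ENNReal.ofReal_le_ofReal (norm_add_le _ _)

variable (Ω) in
/-- The norm `‖T‖ + L(T)`, equal to `∞` if `L(T) = ∞`. -/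
def eLamExtNorm : ExtNorm (L2 Ω →L[ℂ] L2 Ω) where
  toFun := fun T => ‖T‖ₑ + lipConst T
  add_le := fun S T => by
    calc ‖S + T‖ₑ + lipConst (S + T) ≤ (‖S‖ₑ + ‖T‖ₑ) + (lipConst S + lipConst T) :=
          add_le_add (opENorm_add_le S T) (lipConst_add_le _ _)
      _ = _ := by abel
  smul := fun c T => by rw [enorm_smul, lipConst_smul, mul_add]
  eq_zero := fun T h => by
    have h1 : ‖T‖ₑ = 0 := (add_eq_zero.1 h).1
    rw [← ofReal_norm, ENNReal.ofReal_eq_zero] at h1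
    exact norm_le_zero_iff.1 h1

variable (Ω) in
/-- `EΛ(Ω) = {T ∈ B(L²(Ω, λ)) : L(T) < ∞}` with the norm `‖T‖ + L(T)`. -/
abbrev ELam : Type := (eLamExtNorm Ω).Space

lemma mem_eLam_iff (T : L2 Ω →L[ℂ] L2 Ω) : T ∈ (eLamExtNorm Ω).finite ↔ lipConst T < ∞ := by
  have h : ‖T‖ₑ < ∞ := enorm_lt_top
  exact ⟨fun hT => (ENNReal.add_lt_top.1 hT).2, fun hT => ENNReal.add_lt_top.2 ⟨h, hT⟩⟩

/-- The bounded operator on `L²(Ω, λ)` underlying an element of `EΛ(Ω)`. -/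
abbrev ELam.op (T : ELam Ω) : L2 Ω →L[ℂ] L2 Ω := (eLamExtNorm Ω).incl T

variable (Ω) in
/-- The ideal `KΛ(Ω)` of compact operators in `EΛ(Ω)`, with the norm of `EΛ(Ω)`. -/
def KLam : Submodule ℂ (ELam Ω) where
  carrier := {T | IsCompactOperator T.op}
  zero_mem' := by
    simp only [Set.mem_ofPred_eq, map_zero]
    exact isCompactOperator_zero
  add_mem' := fun {S T} hS hT => by
    simp only [Set.mem_ofPred_eq, map_add] at hS hT ⊢
    exact hS.add hT
  smul_mem' := fun c T hT => by
    simp only [Set.mem_ofPred_eq, map_smul] at hT ⊢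
    exact hT.smul c

lemma memLp_coord (hΩ : MeasurableSet Ω) (hb : Bornology.IsBounded Ω) :
    MemLp (fun z : ℂ => z) ∞ (leb Ω) := by
  obtain ⟨C, hC⟩ := hb.exists_norm_le
  exact memLp_top_of_bound measurable_id.aestronglyMeasurable C
    ((ae_restrict_iff' hΩ).2 (Filter.Eventually.of_forall hC))

/-- For a bounded Borel set `Ω`, the operator `Z` of multiplication by `z` on `L²(Ω, λ)`. -/
def opZ (hΩ : MeasurableSet Ω) (hb : Bornology.IsBounded Ω) : L2 Ω →L[ℂ] L2 Ω :=
  mulOp (memLp_coord hΩ hb).toLp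

/-- The predual `(C₁ × C₂) / N` of `EΛ(Ω)`, with the quotient norm. -/
abbrev Predual (hΩ : MeasurableSet Ω) (hb : Bornology.IsBounded Ω) : Type :=
  (C₁ (L2 Ω) × C₂ (L2 Ω)) ⧸ nullPairs (opZ hΩ hb)

/-- The class of `(x, y)` in `(C₁ × C₂) / N`. -/
abbrev cls (hΩ : MeasurableSet Ω) (hb : Bornology.IsBounded Ω) (x : C₁ (L2 Ω))
    (y : C₂ (L2 Ω)) : Predual hΩ hb :=
  Submodule.Quotient.mk (x, y)

/-- The operator `T x + [Z, T] y`. -/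
def pairOp (hΩ : MeasurableSet Ω) (hb : Bornology.IsBounded Ω) (T : ELam Ω) (x : C₁ (L2 Ω))
    (y : C₂ (L2 Ω)) : L2 Ω →L[ℂ] L2 Ω :=
  T.op * (traceExtNorm (L2 Ω)).incl x + comm (opZ hΩ hb) T.op * (hsExtNorm (L2 Ω)).incl y

end Lambda

end AlmostNormal

end

open AlmostNormal MeasureTheory
open scoped ENNReal

/-!
The whole duality rests on two facts about the multiplication operator `Z`.

*An almost commuting approximate unit.* The projection `Eₙ` onto the functions that are constant on
the squares of the grid of side `1/n` has rank `O(n²)` and commutes with an operator at distance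
`O(1/n)` from `Z`, so the Hilbert–Schmidt norms of the commutators `[Z, Eₙ]` are bounded
(`hsNorm_comm_stepProj_le`). Since `Eₙ → 1` strongly, these commutators tend to `0` weakly in `C₂`;
by Mazur's theorem suitable convex combinations `Bₙ` of the `Eₙ` still tend strongly to `1` and
satisfy `|[Z, Bₙ]|₂ → 0` (`exists_approxUnit_opZ`).

*Two consequences.* First, `L(T) = |[Z, T]|₂` (`lipConst_eq`). For a Hilbert–Schmidt operator `T`
and a `1`-Lipschitz `f`, replacing `f` and `z` by step functions with the same sample points turns
`|[M_f, T]|₂ ≤ |[Z, T]|₂` into a comparison of matrix entries, `|f(aᵢ) - f(aⱼ)| ≤ |aᵢ - aⱼ|`; the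
general case follows by applying this to `Bₙ T` and letting `n → ∞`. Second, `Tr [Z, X] = 0` if
`X` is Hilbert–Schmidt and `[Z, X]` is of trace class (`trace_comm_opZ_eq_zero`), because
`Tr (Bₙ [Z, X]) = Tr ([Bₙ, Z] X) → 0`.

The rest is duality. The dual of `C₁` is `B`, the dual of `C₂` is `C₂`, and a bounded functional
on `B` restricts to the compact operators as `Tr (· x)` with `x ∈ C₁`. The norm `‖T‖ + |[Z, T]|₂`
of `EΛ(Ω)` is then the norm of the functional `(x, y) ↦ Tr (T x + [Z, T] y)` on `C₁ × C₂` with the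
maximum norm. This functional vanishes on `N`, as its value at `([Z, h], h)` is `Tr [Z, T h]`;
conversely, a functional given by `(T, S)` that vanishes on `N` satisfies `S = [Z, T]`, as is seen
on `h` of rank one. This gives `Φ`. A functional on `KΛ(Ω)` extends, along `T ↦ (T, [Z, T])`, to
`B × C₂` without increase of the norm, and so comes from a pair `(x, y)` of at most that norm
(`exists_predualToDual_eq`); the pair is unique modulo `N`, since testing on `T` of rank one gives
`x = [Z, y]` if the functional vanishes. This gives `Ψ`, and `Θ` is `Φ` followed by the inverse of
the transpose of `Ψ`.
-/

noncomputable section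

namespace AlmostNormal

open Filter Topology
open scoped InnerProductSpace
open InnerProductSpace (rankOne)

/-! ### Ideal properties of the Hilbert–Schmidt and trace norms -/

section SchattenIdeals

set_option linter.unusedSectionVars false

variable {H : Type*} [NormedAddCommGroup H] [InnerProductSpace ℂ H] [CompleteSpace H]

lemma ExtNorm.enorm_def {E : Type*} [AddCommGroup E] [Module ℂ E] (n : ExtNorm E) (x : n.Space) :
    ‖x‖ₑ = n.toFun (n.incl x) := by
  rw [← ofReal_norm, n.norm_def, ENNReal.ofReal_toReal (n.incl_lt_top x).ne]

lemma hsNorm_sq {ι : Type*} (b : HilbertBasis ι ℂ H) (T : H →L[ℂ] H) :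
    hsNorm T ^ 2 = hsSum b T := by
  unfold hsNorm
  rw [hsSum_indep b (basis H), ← ENNReal.rpow_natCast, ← ENNReal.rpow_mul]
  norm_num

lemma hsNorm_le_iff {T : H →L[ℂ] H} {c : ℝ≥0∞} :
    hsNorm T ≤ c ↔ hsSum (basis H) T ≤ c ^ 2 := by
  rw [← hsNorm_sq (basis H), ENNReal.pow_le_pow_left_iff two_ne_zero]

lemma hsNorm_lt_top_iff {T : H →L[ℂ] H} : hsNorm T < ∞ ↔ hsSum (basis H) T < ∞ := by
  rw [← hsNorm_sq (basis H)]
  simp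

@[simp] lemma traceNorm_zero : traceNorm (0 : H →L[ℂ] H) = 0 := (traceExtNorm H).map_zero

@[simp] lemma hsNorm_neg (T : H →L[ℂ] H) : hsNorm (-T) = hsNorm T := by
  have := hsNorm_smul (-1) T
  simpa using this

@[simp] lemma traceNorm_neg (T : H →L[ℂ] H) : traceNorm (-T) = traceNorm T := by
  have := traceNorm_smul (-1) T
  simpa using this

lemma hsNorm_sub_le (S T : H →L[ℂ] H) : hsNorm (S - T) ≤ hsNorm S + hsNorm T := by
  rw [sub_eq_add_neg, ← hsNorm_neg T]
  exact hsNorm_add_le _ _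

lemma hsNorm_star (T : H →L[ℂ] H) : hsNorm (star T) = hsNorm T := by
  unfold hsNorm
  rw [← hsSum_adjoint]

lemma hsNorm_mul_left_le (A T : H →L[ℂ] H) : hsNorm (A * T) ≤ ‖A‖ₑ * hsNorm T := by
  rw [hsNorm_le_iff, mul_pow, hsNorm_sq (basis H)]
  unfold hsSum
  rw [← ENNReal.tsum_mul_left]
  refine ENNReal.tsum_le_tsum fun i => ?_
  rw [← mul_pow]
  gcongr
  exact A.le_opENorm _

lemma hsNorm_mul_right_le (A T : H →L[ℂ] H) : hsNorm (T * A) ≤ hsNorm T * ‖A‖ₑ := by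
  rw [← hsNorm_star, star_mul, mul_comm]
  refine (hsNorm_mul_left_le _ _).trans_eq ?_
  rw [hsNorm_star, ← ofReal_norm, ← ofReal_norm, norm_star]

lemma hsNorm_rankOne (u v : H) : hsNorm (rankOne ℂ u v) = ‖u‖ₑ * ‖v‖ₑ := by
  have h : hsNorm (rankOne ℂ u v) ^ 2 = (‖u‖ₑ * ‖v‖ₑ) ^ 2 := by
    rw [hsNorm_sq (basis H), mul_pow, ← parseval (basis H) v, ← ENNReal.tsum_mul_left]
    refine tsum_congr fun i => ?_
    rw [InnerProductSpace.rankOne_apply, enorm_smul, mul_pow, mul_comm, ← inner_conj_symm,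
      ← ofReal_norm (starRingEnd ℂ _), RCLike.norm_conj, ofReal_norm]
  exact (ENNReal.pow_right_strictMono two_ne_zero).injective h

lemma tsum_enorm_inner_le_hsNorm {ι : Type*} (b : HilbertBasis ι ℂ H) (C D : H →L[ℂ] H) :
    ∑' i, ‖⟪C (b i), D (b i)⟫_ℂ‖ₑ ≤ hsNorm C * hsNorm D := by
  let : MeasurableSpace ι := ⊤
  have h := ENNReal.lintegral_mul_le_Lp_mul_Lq (μ := (Measure.count : Measure ι))
    (p := 2) (q := 2) (by constructor <;> norm_num)
    (f := fun i => ‖C (b i)‖ₑ) (g := fun i => ‖D (b i)‖ₑ)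
    (measurable_from_top).aemeasurable (measurable_from_top).aemeasurable
  simp only [lintegral_count, Pi.mul_apply, ENNReal.rpow_ofNat] at h
  have e : ∀ T : H →L[ℂ] H, hsNorm T = (∑' i, ‖T (b i)‖ₑ ^ 2) ^ (1 / 2 : ℝ) := fun T => by
    unfold hsNorm
    rw [hsSum_indep (basis H) b, hsSum]
  rw [e C, e D]
  refine le_trans (ENNReal.tsum_le_tsum fun i => ?_) h
  simpa only [← ofReal_norm, ← ENNReal.ofReal_mul (norm_nonneg _)] using
    ENNReal.ofReal_le_ofReal (norm_inner_le_norm (𝕜 := ℂ) (C (b i)) (D (b i)))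

lemma traceNorm_mul_le_hsNorm (C D : H →L[ℂ] H) : traceNorm (C * D) ≤ hsNorm C * hsNorm D := by
  obtain ⟨W, hW, -, hA⟩ := exists_polar (C * D)
  have hW' : ‖W‖ₑ ≤ 1 := by
    rw [← ofReal_norm]
    simpa using ENNReal.ofReal_le_ofReal hW
  calc traceNorm (C * D)
      ≤ ∑' i, ‖⟪(star C * W) (basis H i), D (basis H i)⟫_ℂ‖ₑ := by
        refine ENNReal.tsum_le_tsum fun i => ?_
        rw [hA, mul_apply_eq_comp, ContinuousLinearMap.star_eq_adjoint,
          ContinuousLinearMap.adjoint_inner_right, mul_apply_eq_comp, mul_apply_eq_comp,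
          ContinuousLinearMap.star_eq_adjoint, ContinuousLinearMap.adjoint_inner_left,
          ← ofReal_norm]
        exact ENNReal.ofReal_le_ofReal (Complex.re_le_norm _)
    _ ≤ hsNorm (star C * W) * hsNorm D := tsum_enorm_inner_le_hsNorm _ _ _
    _ ≤ (hsNorm (star C) * 1) * hsNorm D := by
        gcongr
        exact (hsNorm_mul_right_le _ _).trans (by gcongr)
    _ = hsNorm C * hsNorm D := by rw [hsNorm_star, mul_one]

/-- A trace-class operator is a product of two Hilbert–Schmidt operators, by the polar
decomposition `T = (W |T|^{1/2}) |T|^{1/2}`. -/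
lemma exists_mul_eq_of_traceNorm (T : H →L[ℂ] H) :
    ∃ C D : H →L[ℂ] H, T = C * D ∧ hsNorm C ^ 2 ≤ traceNorm T ∧ hsNorm D ^ 2 ≤ traceNorm T := by
  obtain ⟨W, hW, hT, -⟩ := exists_polar T
  refine ⟨W * sqrtAbs T, sqrtAbs T, ?_, ?_, ?_⟩
  · rw [mul_assoc, sqrtAbs_mul, ← hT]
  · rw [hsNorm_sq (basis H), traceNorm_eq_hsSum (basis H)]
    exact hsSum_comp_left_le _ _ _ hW
  · rw [hsNorm_sq (basis H), traceNorm_eq_hsSum (basis H)]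

lemma mul_le_of_sq_le_of_sq_le {a b c : ℝ≥0∞} (ha : a ^ 2 ≤ c) (hb : b ^ 2 ≤ c) : a * b ≤ c := by
  rw [← ENNReal.pow_le_pow_left_iff two_ne_zero, mul_pow, sq c]
  exact mul_le_mul' ha hb

lemma traceNorm_mul_left_le (A T : H →L[ℂ] H) : traceNorm (A * T) ≤ ‖A‖ₑ * traceNorm T := by
  obtain ⟨C, D, h, hC, hD⟩ := exists_mul_eq_of_traceNorm T
  calc traceNorm (A * T) = traceNorm ((A * C) * D) := by rw [mul_assoc, ← h]
    _ ≤ hsNorm (A * C) * hsNorm D := traceNorm_mul_le_hsNorm _ _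
    _ ≤ (‖A‖ₑ * hsNorm C) * hsNorm D := by gcongr; exact hsNorm_mul_left_le _ _
    _ ≤ ‖A‖ₑ * traceNorm T := by
        rw [mul_assoc]
        gcongr
        exact mul_le_of_sq_le_of_sq_le hC hD

lemma traceNorm_mul_right_le (A T : H →L[ℂ] H) : traceNorm (T * A) ≤ traceNorm T * ‖A‖ₑ := by
  obtain ⟨C, D, h, hC, hD⟩ := exists_mul_eq_of_traceNorm T
  calc traceNorm (T * A) = traceNorm (C * (D * A)) := by rw [← mul_assoc, ← h]
    _ ≤ hsNorm C * hsNorm (D * A) := traceNorm_mul_le_hsNorm _ _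
    _ ≤ hsNorm C * (hsNorm D * ‖A‖ₑ) := by gcongr; exact hsNorm_mul_right_le _ _
    _ ≤ traceNorm T * ‖A‖ₑ := by
        rw [← mul_assoc]
        gcongr
        exact mul_le_of_sq_le_of_sq_le hC hD

lemma mul_rankOne (A : H →L[ℂ] H) (u v : H) : A * rankOne ℂ u v = rankOne ℂ (A u) v := by
  ext z; simp [InnerProductSpace.rankOne_apply]

lemma rankOne_mul (A : H →L[ℂ] H) (u v : H) :
    rankOne ℂ u v * A = rankOne ℂ u (star A v) := by
  ext z
  simp [InnerProductSpace.rankOne_apply, ContinuousLinearMap.star_eq_adjoint,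
    ContinuousLinearMap.adjoint_inner_left]

lemma traceNorm_rankOne_le (u v : H) : traceNorm (rankOne ℂ u v) ≤ ‖u‖ₑ * ‖v‖ₑ := by
  rcases eq_or_ne v 0 with rfl | hv
  · simp
  have h : rankOne ℂ u v = rankOne ℂ u ((‖v‖⁻¹ : ℂ) • v) * rankOne ℂ ((‖v‖⁻¹ : ℂ) • v) v := by
    have hv' : (‖v‖ : ℂ) ≠ 0 := by simpa using hv
    rw [mul_rankOne, InnerProductSpace.rankOne_apply, inner_smul_left, inner_smul_right,
      inner_self_eq_norm_sq_to_K]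
    congr 2
    simp
    field_simp
    simp
  have e : ‖(‖v‖⁻¹ : ℂ) • v‖ₑ = 1 := by
    rw [← ofReal_norm, norm_smul]
    simp [hv]
  rw [h]
  refine (traceNorm_mul_le_hsNorm _ _).trans_eq ?_
  rw [hsNorm_rankOne, hsNorm_rankOne, e, mul_one, one_mul]

/-! ### The trace as a linear functional -/

lemma trace_add {S T : H →L[ℂ] H} (hS : traceNorm S < ∞) (hT : traceNorm T < ∞) :
    trace (S + T) = trace S + trace T := by
  have h := (hasSum_trace (basis H) S hS).add (hasSum_trace (basis H) T hT)
  rw [trace, ← h.tsum_eq]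
  exact tsum_congr fun i => by rw [add_apply, inner_add_right]

lemma trace_smul (c : ℂ) (T : H →L[ℂ] H) : trace (c • T) = c * trace T := by
  rw [trace, trace, ← tsum_mul_left]
  exact tsum_congr fun i => by rw [smul_apply, inner_smul_right]

lemma trace_neg (T : H →L[ℂ] H) : trace (-T) = -trace T := by
  simpa using trace_smul (-1) T

lemma traceNorm_sub_lt_top {S T : H →L[ℂ] H} (hS : traceNorm S < ∞) (hT : traceNorm T < ∞) :
    traceNorm (S - T) < ∞ := by
  rw [sub_eq_add_neg]
  exact (traceNorm_add_le _ _).trans_lt (ENNReal.add_lt_top.2 ⟨hS, by simpa using hT⟩)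

lemma trace_sub {S T : H →L[ℂ] H} (hS : traceNorm S < ∞) (hT : traceNorm T < ∞) :
    trace (S - T) = trace S - trace T := by
  rw [sub_eq_add_neg, trace_add hS (by simpa using hT), trace_neg, sub_eq_add_neg]

lemma enorm_trace_le (T : H →L[ℂ] H) : ‖trace T‖ₑ ≤ traceNorm T := by
  rcases eq_or_ne (traceNorm T) ∞ with h | h
  · simp [h]
  have h1 := tsum_enorm_inner_le (basis H) 1 T ContinuousLinearMap.norm_id_le
  refine le_trans ?_ h1
  exact enorm_tsum_le_tsum_enorm

lemma trace_rankOne (u v : H) : trace (rankOne ℂ u v) = ⟪v, u⟫_ℂ := by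
  have h := (basis H).hasSum_inner_mul_inner v u
  rw [← h.tsum_eq, trace]
  exact tsum_congr fun i => by
    rw [InnerProductSpace.rankOne_apply, inner_smul_right]

end SchattenIdeals

/-! ### Approximation by operators tending strongly to the identity -/

section StrongApprox

set_option linter.unusedSectionVars false

variable {H : Type*} [NormedAddCommGroup H] [InnerProductSpace ℂ H] [CompleteSpace H]

lemma hsSum_eq_ofReal_tsum {ι : Type*} (b : HilbertBasis ι ℂ H) (T : H →L[ℂ] H)
    (h : Summable fun i => ‖T (b i)‖ ^ 2) :
    hsSum b T = ENNReal.ofReal (∑' i, ‖T (b i)‖ ^ 2) := by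
  rw [ENNReal.ofReal_tsum_of_nonneg (fun i => sq_nonneg _) h]
  exact tsum_congr fun i => by rw [ENNReal.ofReal_pow (norm_nonneg _), ofReal_norm]

section

variable {α : Type*} {l : Filter α} {A : α → H →L[ℂ] H}
  (hA : ∀ a, ‖A a‖ ≤ 1) (hs : ∀ v, Tendsto (fun a => A a v) l (𝓝 v))

include hA hs

lemma tendsto_hsNorm_mul_sub {X : H →L[ℂ] H} (hX : hsNorm X < ∞) :
    Tendsto (fun a => hsNorm (A a * X - X)) l (𝓝 0) := by
  have hsum := (hasSum_norm_sq (basis H) X (hsNorm_lt_top_iff.1 hX).ne).summable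
  have hbound : ∀ a i, ‖(A a * X - X) (basis H i)‖ ^ 2 ≤ 4 * ‖X (basis H i)‖ ^ 2 := fun a i => by
    have : ‖(A a * X - X) (basis H i)‖ ≤ 2 * ‖X (basis H i)‖ := by
      calc ‖(A a * X - X) (basis H i)‖ ≤ ‖A a (X (basis H i))‖ + ‖X (basis H i)‖ := norm_sub_le _ _
        _ ≤ 1 * ‖X (basis H i)‖ + ‖X (basis H i)‖ := by
            gcongr
            exact (A a).le_of_opNorm_le (hA a) _
        _ = _ := by ring
    calc _ ≤ (2 * ‖X (basis H i)‖) ^ 2 := by gcongr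
      _ = _ := by ring
  have h1 : Tendsto (fun a => ∑' i, ‖(A a * X - X) (basis H i)‖ ^ 2) l
      (𝓝 (∑' _ : basisIndex H, (0 : ℝ))) := by
    refine tendsto_tsum_of_dominated_convergence (hsum.mul_left 4) (fun i => ?_)
      (Eventually.of_forall fun a i => ?_)
    · have h2 := ((hs (X (basis H i))).sub_const (X (basis H i))).norm.pow 2
      simpa using h2
    · rw [Real.norm_of_nonneg (sq_nonneg _)]
      exact hbound a i
  rw [tsum_zero] at h1
  have h3 := (ENNReal.continuous_rpow_const (y := (1 / 2 : ℝ))).tendsto 0 |>.comp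
    (by simpa using ENNReal.tendsto_ofReal h1)
  rw [ENNReal.zero_rpow_of_pos (by norm_num)] at h3
  refine h3.congr fun a => ?_
  rw [hsNorm, hsSum_eq_ofReal_tsum]
  · rfl
  · exact (hsum.mul_left 4).of_nonneg_of_le (fun i => sq_nonneg _) (hbound a)

lemma tendsto_traceNorm_mul_sub {X : H →L[ℂ] H} (hX : traceNorm X < ∞) :
    Tendsto (fun a => traceNorm (A a * X - X)) l (𝓝 0) := by
  obtain ⟨C, D, rfl, hC, hD⟩ := exists_mul_eq_of_traceNorm X
  have hfin : ∀ {c : ℝ≥0∞}, c ^ 2 ≤ traceNorm (C * D) → c < ∞ := fun {c} h => by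
    have := h.trans_lt hX
    by_contra hc
    simp [not_lt_top_iff.1 hc] at this
  have h := ENNReal.Tendsto.mul_const (b := hsNorm D) (tendsto_hsNorm_mul_sub hA hs (hfin hC))
    (Or.inr (hfin hD).ne)
  rw [zero_mul] at h
  refine tendsto_of_tendsto_of_tendsto_of_le_of_le tendsto_const_nhds h (fun _ => zero_le)
    fun a => ?_
  rw [← mul_assoc, ← sub_mul]
  exact traceNorm_mul_le_hsNorm _ _

lemma tendsto_norm_mul_sub {K : H →L[ℂ] H} (hK : IsCompactOperator K) :
    Tendsto (fun a => A a * K) l (𝓝 K) := by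
  obtain ⟨S, hS, hKS⟩ := hK.image_closedBall_subset_compact (𝕜₁ := ℂ) 1
  rw [Metric.tendsto_nhds]
  intro ε hε
  obtain ⟨t, -, htf, ht⟩ := hS.finite_cover_balls (e := ε / 4) (by positivity)
  have h1 : ∀ᶠ a in l, ∀ w ∈ t, ‖A a w - w‖ < ε / 4 := by
    rw [htf.eventually_all]
    intro w _
    have := (Metric.tendsto_nhds.1 (hs w)) (ε / 4) (by positivity)
    simpa [dist_eq_norm] using this
  filter_upwards [h1] with a ha
  rw [dist_eq_norm]
  refine lt_of_le_of_lt (ContinuousLinearMap.opNorm_le_of_unit_norm (C := 3 * ε / 4)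
    (by positivity) fun x hx => ?_) (by linarith)
  have hmem : K x ∈ S := hKS ⟨x, by simp [hx], rfl⟩
  obtain ⟨w, hw, hxw⟩ := Set.mem_iUnion₂.1 (ht hmem)
  rw [Metric.mem_ball, dist_eq_norm] at hxw
  have e : (A a * K - K) x = A a (K x - w) + (A a w - w) + (w - K x) := by
    simp
  calc ‖(A a * K - K) x‖ ≤ ‖A a (K x - w)‖ + ‖A a w - w‖ + ‖w - K x‖ := by
        rw [e]; exact norm_add₃_le
    _ ≤ 1 * ‖K x - w‖ + ‖A a w - w‖ + ‖K x - w‖ := by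
        rw [norm_sub_rev w]
        gcongr
        exact (A a).le_of_opNorm_le (hA a) _
    _ ≤ 3 * ε / 4 := by linarith [ha w hw]

end

/-- The orthogonal projection onto the span of finitely many vectors of the fixed basis. -/
def finProj (F : Finset (basisIndex H)) : H →L[ℂ] H :=
  ∑ i ∈ F, rankOne ℂ (basis H i) (basis H i)

lemma finProj_apply (F : Finset (basisIndex H)) (v : H) :
    finProj F v = ∑ i ∈ F, ⟪basis H i, v⟫_ℂ • basis H i := by
  simp [finProj, sum_apply, InnerProductSpace.rankOne_apply]

lemma norm_finProj_le (F : Finset (basisIndex H)) : ‖finProj F‖ ≤ 1 := by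
  refine ContinuousLinearMap.opNorm_le_bound _ zero_le_one fun v => ?_
  rw [one_mul, ← sq_le_sq₀ (norm_nonneg _) (norm_nonneg _), finProj_apply]
  have h := (basis H).orthonormal.sum_inner_products_le v (s := F)
  refine le_trans (le_of_eq ?_) h
  have h2 := (basis H).orthonormal.inner_sum (fun i => ⟪basis H i, v⟫_ℂ)
    (fun i => ⟪basis H i, v⟫_ℂ) F
  rw [inner_self_eq_norm_sq_to_K] at h2
  have h3 : ∀ z : ℂ, (starRingEnd ℂ) z * z = ((‖z‖ ^ 2 : ℝ) : ℂ) := fun z => by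
    rw [← Complex.normSq_eq_conj_mul_self, Complex.normSq_eq_norm_sq]
  simp_rw [h3] at h2
  apply Complex.ofReal_injective
  push_cast
  push_cast at h2
  exact h2

lemma tendsto_finProj (v : H) :
    Tendsto (fun F : Finset (basisIndex H) => finProj F v) atTop (𝓝 v) := by
  have h := (basis H).hasSum_repr v
  simp_rw [finProj_apply]
  simpa [HasSum, (basis H).repr_apply_apply] using h

lemma finProj_mul (F : Finset (basisIndex H)) (X : H →L[ℂ] H) :
    finProj F * X = ∑ i ∈ F, rankOne ℂ (basis H i) (star X (basis H i)) := by
  rw [finProj, Finset.sum_mul]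
  exact Finset.sum_congr rfl fun i _ => rankOne_mul _ _ _

/-! ### Functionals determined by operators of rank one -/

/-- A vector of finite norm, as an element of `n.Space`. -/
def ExtNorm.ofFinite {E : Type*} [AddCommGroup E] [Module ℂ E] (n : ExtNorm E) (x : E)
    (h : n.toFun x < ∞) : n.Space := (⟨x, h⟩ : n.finite)

/-- If the projections `finProj F` approximate every element in the norm `n`, then a continuous
functional for `n` is determined by its values on operators of rank one. -/
lemma ExtNorm.dual_ext_of_rankOne (n : ExtNorm (H →L[ℂ] H))
    (hr : ∀ u v : H, n.toFun (rankOne ℂ u v) < ∞)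
    (hn : ∀ x : n.Space, Tendsto (fun F => n.toFun (finProj F * n.incl x - n.incl x)) atTop (𝓝 0))
    {φ ψ : StrongDual ℂ n.Space}
    (h : ∀ u v, φ (n.ofFinite (rankOne ℂ u v) (hr u v)) = ψ (n.ofFinite (rankOne ℂ u v) (hr u v))) :
    φ = ψ := by
  ext x
  let y : Finset (basisIndex H) → n.Space := fun F =>
    ∑ i ∈ F, n.ofFinite (rankOne ℂ (basis H i) (star (n.incl x) (basis H i))) (hr _ _)
  have hy : ∀ F, n.incl (y F) = finProj F * n.incl x := fun F => by
    rw [map_sum, finProj_mul]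
    rfl
  have hlim : Tendsto y atTop (𝓝 x) := by
    rw [tendsto_iff_edist_tendsto_0]
    refine (hn x).congr fun F => ?_
    rw [edist_eq_enorm_sub, n.enorm_def, map_sub, hy]
  have he : ∀ F, φ (y F) = ψ (y F) := fun F => by
    rw [map_sum, map_sum]
    exact Finset.sum_congr rfl fun i _ => h _ _
  refine tendsto_nhds_unique ((φ.continuous.tendsto x).comp hlim) ?_
  exact ((ψ.continuous.tendsto x).comp hlim).congr fun F => (he F).symm

variable (H) in
lemma traceNorm_rankOne_lt_top (u v : H) : traceNorm (rankOne ℂ u v) < ∞ :=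
  (traceNorm_rankOne_le u v).trans_lt (ENNReal.mul_lt_top enorm_lt_top enorm_lt_top)

lemma hsNorm_rankOne_lt_top (u v : H) : hsNorm (rankOne ℂ u v) < ∞ := by
  rw [hsNorm_rankOne]
  exact ENNReal.mul_lt_top enorm_lt_top enorm_lt_top

/-- An operator of rank one as an element of `C₁`. -/
def C₁.rankOne (u v : H) : C₁ H :=
  (traceExtNorm H).ofFinite (InnerProductSpace.rankOne ℂ u v) (traceNorm_rankOne_lt_top H u v)

/-- An operator of rank one as an element of `C₂`. -/
def C₂.rankOne (u v : H) : C₂ H :=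
  (hsExtNorm H).ofFinite (InnerProductSpace.rankOne ℂ u v) (hsNorm_rankOne_lt_top u v)

lemma C₁.dual_ext {φ ψ : StrongDual ℂ (C₁ H)}
    (h : ∀ u v, φ (C₁.rankOne u v) = ψ (C₁.rankOne u v)) : φ = ψ :=
  (traceExtNorm H).dual_ext_of_rankOne (traceNorm_rankOne_lt_top H)
    (fun x => tendsto_traceNorm_mul_sub norm_finProj_le tendsto_finProj
      ((traceExtNorm H).incl_lt_top x)) h

lemma C₂.dual_ext {φ ψ : StrongDual ℂ (C₂ H)}
    (h : ∀ u v, φ (C₂.rankOne u v) = ψ (C₂.rankOne u v)) : φ = ψ :=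
  (hsExtNorm H).dual_ext_of_rankOne hsNorm_rankOne_lt_top
    (fun x => tendsto_hsNorm_mul_sub norm_finProj_le tendsto_finProj
      ((hsExtNorm H).incl_lt_top x)) h

lemma dual_apply_eq_of_isCompactOperator {φ ψ : StrongDual ℂ (H →L[ℂ] H)}
    (h : ∀ u v, φ (rankOne ℂ u v) = ψ (rankOne ℂ u v)) {K : H →L[ℂ] H}
    (hK : IsCompactOperator K) : φ K = ψ K := by
  have hlim := tendsto_norm_mul_sub norm_finProj_le tendsto_finProj hK
  refine tendsto_nhds_unique ((φ.continuous.tendsto K).comp hlim) ?_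
  refine ((ψ.continuous.tendsto K).comp hlim).congr fun F => ?_
  simp only [Function.comp, finProj_mul, map_sum]
  exact Finset.sum_congr rfl fun i _ => (h _ _).symm

end StrongApprox

/-! ### The duals of the trace class and of the Hilbert–Schmidt class -/

section Duality

set_option linter.unusedSectionVars false

variable {H : Type*} [NormedAddCommGroup H] [InnerProductSpace ℂ H] [CompleteSpace H]

/-- The functional `x ↦ Tr (T x)` on `C₁`. -/
def traceDual (T : H →L[ℂ] H) : StrongDual ℂ (C₁ H) :=
  LinearMap.mkContinuous
    { toFun := fun x => trace (T * (traceExtNorm H).incl x)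
      map_add' := fun x y => by
        rw [map_add, mul_add]
        exact trace_add
          ((traceNorm_mul_left_le _ _).trans_lt (ENNReal.mul_lt_top enorm_lt_top
            ((traceExtNorm H).incl_lt_top x)))
          ((traceNorm_mul_left_le _ _).trans_lt (ENNReal.mul_lt_top enorm_lt_top
            ((traceExtNorm H).incl_lt_top y)))
      map_smul' := fun c x => by
        rw [map_smul, mul_smul_comm, trace_smul]
        rfl } ‖T‖ fun x => by
    have h := (enorm_trace_le _).trans (traceNorm_mul_left_le T ((traceExtNorm H).incl x))
    have h2 : ‖trace (T * (traceExtNorm H).incl x)‖ₑ ≤ ‖T‖ₑ * ‖x‖ₑ := by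
      rwa [(traceExtNorm H).enorm_def]
    rw [← ofReal_norm, ← ofReal_norm, ← ofReal_norm, ← ENNReal.ofReal_mul (norm_nonneg _),
      ENNReal.ofReal_le_ofReal_iff (by positivity)] at h2
    exact h2

lemma traceDual_apply (T : H →L[ℂ] H) (x : C₁ H) :
    traceDual T x = trace (T * (traceExtNorm H).incl x) := rfl

lemma traceDual_rankOne (T : H →L[ℂ] H) (u v : H) :
    traceDual T (C₁.rankOne u v) = ⟪v, T u⟫_ℂ := by
  rw [traceDual_apply]
  change trace (T * rankOne ℂ u v) = _
  rw [mul_rankOne, trace_rankOne]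

lemma norm_traceDual_le (T : H →L[ℂ] H) : ‖traceDual T‖ ≤ ‖T‖ :=
  LinearMap.mkContinuous_norm_le _ (norm_nonneg _) _

/-- The functional `y ↦ Tr (S y)` on `C₂`, for a Hilbert–Schmidt operator `S`. -/
def hsDual (S : C₂ H) : StrongDual ℂ (C₂ H) :=
  LinearMap.mkContinuous
    { toFun := fun y => trace ((hsExtNorm H).incl S * (hsExtNorm H).incl y)
      map_add' := fun x y => by
        rw [map_add, mul_add]
        exact trace_add
          ((traceNorm_mul_le_hsNorm _ _).trans_lt (ENNReal.mul_lt_top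
            ((hsExtNorm H).incl_lt_top S) ((hsExtNorm H).incl_lt_top x)))
          ((traceNorm_mul_le_hsNorm _ _).trans_lt (ENNReal.mul_lt_top
            ((hsExtNorm H).incl_lt_top S) ((hsExtNorm H).incl_lt_top y)))
      map_smul' := fun c x => by
        rw [map_smul, mul_smul_comm, trace_smul]
        rfl } ‖S‖ fun y => by
    have h := (enorm_trace_le _).trans
      (traceNorm_mul_le_hsNorm ((hsExtNorm H).incl S) ((hsExtNorm H).incl y))
    have h2 : ‖trace ((hsExtNorm H).incl S * (hsExtNorm H).incl y)‖ₑ ≤ ‖S‖ₑ * ‖y‖ₑ := by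
      rwa [(hsExtNorm H).enorm_def, (hsExtNorm H).enorm_def]
    rw [← ofReal_norm, ← ofReal_norm, ← ofReal_norm, ← ENNReal.ofReal_mul (norm_nonneg _),
      ENNReal.ofReal_le_ofReal_iff (by positivity)] at h2
    exact h2

lemma hsDual_apply (S y : C₂ H) :
    hsDual S y = trace ((hsExtNorm H).incl S * (hsExtNorm H).incl y) := rfl

lemma hsDual_rankOne (S : C₂ H) (u v : H) :
    hsDual S (C₂.rankOne u v) = ⟪v, (hsExtNorm H).incl S u⟫_ℂ := by
  rw [hsDual_apply]
  change trace (_ * rankOne ℂ u v) = _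
  rw [mul_rankOne, trace_rankOne]

lemma norm_hsDual_le (S : C₂ H) : ‖hsDual S‖ ≤ ‖S‖ :=
  LinearMap.mkContinuous_norm_le _ (norm_nonneg _) _

/-- A bounded sesquilinear form is of the form `(u, v) ↦ ⟪v, S u⟫`. -/
lemma exists_op_of_sesquilinear (g : H → H → ℂ) (C : ℝ)
    (add_left : ∀ u u' v, g (u + u') v = g u v + g u' v)
    (add_right : ∀ u v v', g u (v + v') = g u v + g u v')
    (smul_left : ∀ (c : ℂ) u v, g (c • u) v = c * g u v)
    (smul_right : ∀ (c : ℂ) u v, g u (c • v) = starRingEnd ℂ c * g u v)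
    (bound : ∀ u v, ‖g u v‖ ≤ C * ‖u‖ * ‖v‖) :
    ∃ S : H →L[ℂ] H, ∀ u v, g u v = ⟪v, S u⟫_ℂ := by
  let B : H →L⋆[ℂ] H →L[ℂ] ℂ := LinearMap.mkContinuous₂
    (LinearMap.mk₂'ₛₗ (starRingEnd ℂ) (RingHom.id ℂ) (fun v u => g u v)
      (fun v v' u => add_right u v v') (fun c v u => smul_right c u v)
      (fun v u u' => add_left u u' v) (fun c v u => smul_left c u v)) C
    (fun v u => by
      refine (bound u v).trans_eq ?_
      ring)
  refine ⟨star (InnerProductSpace.continuousLinearMapOfBilin B), fun u v => ?_⟩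
  rw [ContinuousLinearMap.star_eq_adjoint, ContinuousLinearMap.adjoint_inner_right,
    InnerProductSpace.continuousLinearMapOfBilin_apply]
  rfl

lemma norm_le_of_dual_rankOne {φ : StrongDual ℂ (C₁ H)} {T : H →L[ℂ] H}
    (h : ∀ u v, φ (C₁.rankOne u v) = ⟪v, T u⟫_ℂ) : ‖T‖ ≤ ‖φ‖ := by
  refine ContinuousLinearMap.opNorm_le_bound _ (norm_nonneg _) fun u => ?_
  have h1 : ‖C₁.rankOne u (T u)‖ ≤ ‖u‖ * ‖T u‖ := by
    have := traceNorm_rankOne_le u (T u)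
    rw [← ofReal_norm, ← ofReal_norm, ← ENNReal.ofReal_mul (norm_nonneg _)] at this
    exact ENNReal.toReal_le_of_le_ofReal (by positivity) this
  have h2 := φ.le_of_opNorm_le_of_le le_rfl h1
  rw [h, inner_self_eq_norm_sq_to_K] at h2
  have h3 : ‖T u‖ * ‖T u‖ ≤ (‖φ‖ * ‖u‖) * ‖T u‖ := by
    simpa [sq, mul_assoc] using h2
  rcases (norm_nonneg (T u)).eq_or_lt with h0 | h0
  · rw [← h0]; positivity
  · exact le_of_mul_le_mul_right h3 h0

lemma hsNorm_finProj_mul_sq (F : Finset (basisIndex H)) (X : H →L[ℂ] H) :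
    hsNorm (finProj F * X) ^ 2 = ∑ i ∈ F, ‖star X (basis H i)‖ₑ ^ 2 := by
  classical
  have hstar : star (finProj F : H →L[ℂ] H) = finProj F := by
    rw [finProj, star_sum]
    refine Finset.sum_congr rfl fun i _ => ?_
    rw [ContinuousLinearMap.star_eq_adjoint, InnerProductSpace.adjoint_rankOne]
  rw [← hsNorm_star, star_mul, hstar, hsNorm_sq (basis H), hsSum, tsum_eq_sum (s := F)]
  · refine Finset.sum_congr rfl fun i hi => ?_
    rw [mul_apply_eq_comp, finProj_apply, Finset.sum_eq_single_of_mem i hi]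
    · simp [(basis H).orthonormal.1]
    · intro j _ hj
      rw [(basis H).orthonormal.2 hj, zero_smul]
  · intro i hi
    rw [mul_apply_eq_comp, finProj_apply, Finset.sum_eq_zero]
    · simp
    · intro j hj
      rw [(basis H).orthonormal.2 (by rintro rfl; exact hi hj), zero_smul]

/-- Testing the functional on the operators `finProj F * S*` bounds the partial sums of
`∑ᵢ ‖S eᵢ‖²`. -/
lemma hsNorm_le_of_dual_rankOne {φ : StrongDual ℂ (C₂ H)} {S : H →L[ℂ] H}
    (h : ∀ u v, φ (C₂.rankOne u v) = ⟪v, S u⟫_ℂ) : hsNorm S ≤ ‖φ‖ₑ := by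
  rw [hsNorm_le_iff]
  unfold hsSum
  rw [ENNReal.tsum_eq_iSup_sum]
  refine iSup_le fun F => ?_
  let y : C₂ H := ∑ i ∈ F, C₂.rankOne (basis H i) (S (basis H i))
  have hy : (hsExtNorm H).incl y = finProj F * star S := by
    rw [map_sum, finProj_mul, star_star]
    rfl
  set a : ℝ≥0∞ := ∑ i ∈ F, ‖S (basis H i)‖ₑ ^ 2
  have hya : ‖y‖ₑ ^ 2 = a := by
    rw [(hsExtNorm H).enorm_def, hy]
    change hsNorm _ ^ 2 = _
    rw [hsNorm_finProj_mul_sq, star_star]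
  have hφ : ‖φ y‖ₑ = a := by
    have e : φ y = ((∑ i ∈ F, ‖S (basis H i)‖ ^ 2 : ℝ) : ℂ) := by
      rw [map_sum]
      push_cast
      refine Finset.sum_congr rfl fun i _ => ?_
      rw [h, inner_self_eq_norm_sq_to_K]
      rfl
    rw [e, ← ofReal_norm, Complex.norm_real, Real.norm_of_nonneg (by positivity),
      ENNReal.ofReal_sum_of_nonneg (fun _ _ => by positivity)]
    exact Finset.sum_congr rfl fun i _ => by
      rw [ENNReal.ofReal_pow (norm_nonneg _), ofReal_norm]
  have h1 : ‖y‖ₑ * ‖y‖ₑ ≤ ‖φ‖ₑ * ‖y‖ₑ := by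
    rw [← sq, hya, ← hφ]
    exact φ.le_opENorm y
  rw [← hya]
  rcases eq_or_ne ‖y‖ₑ 0 with h0 | h0
  · rw [h0]; simp
  · gcongr
    exact (ENNReal.mul_le_mul_iff_left h0 enorm_ne_top).1 h1

/-- Testing the functional on the contractions `finProj F * W*`, where `|x| = W* x`, bounds the
partial sums of `∑ᵢ ⟪eᵢ, |x| eᵢ⟫`. -/
lemma traceNorm_le_of_dual_rankOne {φ : StrongDual ℂ (H →L[ℂ] H)} {x : H →L[ℂ] H}
    (h : ∀ u v, φ (rankOne ℂ u v) = ⟪v, x u⟫_ℂ) : traceNorm x ≤ ‖φ‖ₑ := by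
  obtain ⟨W, hW, -, hA⟩ := exists_polar x
  unfold traceNorm
  rw [ENNReal.tsum_eq_iSup_sum]
  refine iSup_le fun F => ?_
  have hnn : ∀ i, 0 ≤ (⟪basis H i, CFC.abs x (basis H i)⟫_ℂ).re := fun i => by
    rw [inner_abs, Complex.ofReal_re]
    positivity
  rw [← ENNReal.ofReal_sum_of_nonneg (fun i _ => hnn i), ← ofReal_norm φ]
  refine ENNReal.ofReal_le_ofReal ?_
  have e : (∑ i ∈ F, (⟪basis H i, CFC.abs x (basis H i)⟫_ℂ).re)
      = (φ (finProj F * star W)).re := by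
    rw [finProj_mul, map_sum, Complex.re_sum]
    refine Finset.sum_congr rfl fun i _ => ?_
    rw [h, star_star, hA, mul_apply_eq_comp, ContinuousLinearMap.star_eq_adjoint,
      ContinuousLinearMap.adjoint_inner_right]
  rw [e]
  refine (Complex.re_le_norm _).trans (φ.le_of_opNorm_le_of_le le_rfl ?_ |>.trans_eq (mul_one _))
  exact (norm_mul_le _ _).trans (mul_le_one₀ (norm_finProj_le F) (norm_nonneg _)
    (by rwa [norm_star]))

lemma norm_traceDual (T : H →L[ℂ] H) : ‖traceDual T‖ = ‖T‖ :=
  (norm_traceDual_le T).antisymm (norm_le_of_dual_rankOne (traceDual_rankOne T))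

lemma norm_hsDual (S : C₂ H) : ‖hsDual S‖ = ‖S‖ := by
  refine (norm_hsDual_le S).antisymm ?_
  have h := hsNorm_le_of_dual_rankOne (hsDual_rankOne S)
  change (hsExtNorm H).toFun _ ≤ _ at h
  rw [← (hsExtNorm H).enorm_def, ← ofReal_norm, ← ofReal_norm] at h
  exact (ENNReal.ofReal_le_ofReal_iff (norm_nonneg _)).1 h

/-- With `r u v` the operator `|u⟩⟨v|` viewed in one of the spaces `C₁`, `C₂` or `B`, every bounded
functional is given on the operators of rank one by the matrix entries of a bounded operator. -/
lemma exists_op_of_linear {E : Type*} [SeminormedAddCommGroup E] [NormedSpace ℂ E]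
    (φ : StrongDual ℂ E) (r : H → H → E)
    (add_left : ∀ u u' v, r (u + u') v = r u v + r u' v)
    (add_right : ∀ u v v', r u (v + v') = r u v + r u v')
    (smul_left : ∀ (c : ℂ) u v, r (c • u) v = c • r u v)
    (smul_right : ∀ (c : ℂ) u v, r u (c • v) = starRingEnd ℂ c • r u v)
    (bound : ∀ u v, ‖r u v‖ₑ ≤ ‖u‖ₑ * ‖v‖ₑ) :
    ∃ S : H →L[ℂ] H, ∀ u v, φ (r u v) = ⟪v, S u⟫_ℂ := by
  refine exists_op_of_sesquilinear (fun u v => φ (r u v)) ‖φ‖ ?_ ?_ ?_ ?_ ?_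
  · intro u u' v; simp only [add_left, map_add]
  · intro u v v'; simp only [add_right, map_add]
  · intro c u v; simp only [smul_left, map_smul, smul_eq_mul]
  · intro c u v; simp only [smul_right, map_smul, smul_eq_mul]
  · intro u v
    rw [mul_assoc]
    refine φ.le_of_opNorm_le_of_le le_rfl ?_
    have := bound u v
    rwa [← ofReal_norm, ← ofReal_norm, ← ofReal_norm, ← ENNReal.ofReal_mul (norm_nonneg _),
      ENNReal.ofReal_le_ofReal_iff (by positivity)] at this

lemma exists_traceDual_eq (φ : StrongDual ℂ (C₁ H)) : ∃ T, traceDual T = φ := by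
  obtain ⟨T, hT⟩ := exists_op_of_linear φ C₁.rankOne
    (fun u u' v => (traceExtNorm H).incl_injective (by simp [C₁.rankOne]; rfl))
    (fun u v v' => (traceExtNorm H).incl_injective (by simp [C₁.rankOne]; rfl))
    (fun c u v => (traceExtNorm H).incl_injective (by simp [C₁.rankOne]; rfl))
    (fun c u v => (traceExtNorm H).incl_injective (by simp [C₁.rankOne]; rfl))
    (fun u v => by
      rw [(traceExtNorm H).enorm_def]
      exact traceNorm_rankOne_le u v)
  exact ⟨T, C₁.dual_ext fun u v => by rw [traceDual_rankOne, hT]⟩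

lemma exists_hsDual_eq (φ : StrongDual ℂ (C₂ H)) : ∃ S, hsDual S = φ := by
  obtain ⟨S, hS⟩ := exists_op_of_linear φ C₂.rankOne
    (fun u u' v => (hsExtNorm H).incl_injective (by simp [C₂.rankOne]; rfl))
    (fun u v v' => (hsExtNorm H).incl_injective (by simp [C₂.rankOne]; rfl))
    (fun c u v => (hsExtNorm H).incl_injective (by simp [C₂.rankOne]; rfl))
    (fun c u v => (hsExtNorm H).incl_injective (by simp [C₂.rankOne]; rfl))
    (fun u v => by
      rw [(hsExtNorm H).enorm_def]
      exact (hsNorm_rankOne u v).le)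
  exact ⟨(hsExtNorm H).ofFinite S ((hsNorm_le_of_dual_rankOne hS).trans_lt enorm_lt_top),
    C₂.dual_ext fun u v => by rw [hsDual_rankOne, hS]; rfl⟩

/-- The trace is cyclic on products of a bounded and a trace-class operator. -/
lemma trace_mul_comm (A : H →L[ℂ] H) {X : H →L[ℂ] H} (hX : traceNorm X < ∞) :
    trace (A * X) = trace (X * A) := by
  have hlt : ∀ Y : C₁ H, traceNorm ((traceExtNorm H).incl Y * A) < ∞ := fun Y =>
    (traceNorm_mul_right_le _ _).trans_lt
      (ENNReal.mul_lt_top ((traceExtNorm H).incl_lt_top Y) enorm_lt_top)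
  let R : StrongDual ℂ (C₁ H) := (traceDual (1 : H →L[ℂ] H)).comp <| LinearMap.mkContinuous
    (σ := RingHom.id ℂ) (F := C₁ H)
    { toFun := fun Y => (traceExtNorm H).ofFinite _ (hlt Y)
      map_add' := fun Y Y' => (traceExtNorm H).incl_injective (by simp [add_mul]; rfl)
      map_smul' := fun c Y => (traceExtNorm H).incl_injective (by simp; rfl) } ‖A‖ fun Y => by
    have h : ‖(traceExtNorm H).ofFinite _ (hlt Y)‖ₑ ≤ ‖Y‖ₑ * ‖A‖ₑ := by
      rw [(traceExtNorm H).enorm_def, (traceExtNorm H).enorm_def]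
      exact traceNorm_mul_right_le _ _
    rwa [← ofReal_norm, ← ofReal_norm, ← ofReal_norm, ← ENNReal.ofReal_mul (norm_nonneg _),
      ENNReal.ofReal_le_ofReal_iff (by positivity), mul_comm] at h
  have hR : ∀ Y, R Y = trace ((traceExtNorm H).incl Y * A) := fun Y => by
    change trace (1 * ((traceExtNorm H).incl Y * A)) = _
    rw [one_mul]
  have h : traceDual A = R := C₁.dual_ext fun u v => by
    rw [traceDual_rankOne, hR]
    change _ = trace (rankOne ℂ u v * A)
    rw [rankOne_mul, trace_rankOne, ContinuousLinearMap.star_eq_adjoint,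
      ContinuousLinearMap.adjoint_inner_left]
  have h2 := DFunLike.congr_fun h ((traceExtNorm H).ofFinite X hX)
  rw [hR] at h2
  exact h2

end Duality

/-! ### Commutators with diagonal operators -/

section Partition

set_option linter.unusedSectionVars false

variable {H : Type*} [NormedAddCommGroup H] [InnerProductSpace ℂ H] [CompleteSpace H]

lemma comm_sub_left (A B X : H →L[ℂ] H) : comm (A - B) X = comm A X - comm B X := by
  unfold comm
  noncomm_ring

lemma comm_mul (A X Y : H →L[ℂ] H) : comm A (X * Y) = comm A X * Y + X * comm A Y := by
  unfold comm
  noncomm_ring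

lemma hsNorm_comm_le (A X : H →L[ℂ] H) : hsNorm (comm A X) ≤ 2 * ‖A‖ₑ * hsNorm X := by
  refine (hsNorm_sub_le _ _).trans ?_
  calc hsNorm (A * X) + hsNorm (X * A) ≤ ‖A‖ₑ * hsNorm X + hsNorm X * ‖A‖ₑ :=
        add_le_add (hsNorm_mul_left_le _ _) (hsNorm_mul_right_le _ _)
    _ = _ := by ring

lemma hsNorm_comm_le_ofReal {A : H →L[ℂ] H} {c : ℝ} (hA : ‖A‖ ≤ c) (X : H →L[ℂ] H) :
    hsNorm (comm A X) ≤ ENNReal.ofReal (2 * c) * hsNorm X := by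
  refine (hsNorm_comm_le A X).trans ?_
  gcongr
  rw [← ofReal_norm, ENNReal.ofReal_mul zero_le_two, ENNReal.ofReal_ofNat]
  gcongr

/-- A finite family of mutually orthogonal projections with sum `1`. -/
structure IsProjPartition {ι : Type*} (s : Finset ι) (P : ι → H →L[ℂ] H) : Prop where
  star_eq : ∀ i, star (P i) = P i
  mul_self : ∀ i, P i * P i = P i
  mul_eq_zero : ∀ i j, i ≠ j → P i * P j = 0
  sum_eq_one : ∑ i ∈ s, P i = 1

namespace IsProjPartition

variable {ι : Type*} {s : Finset ι} {P : ι → H →L[ℂ] H} (hP : IsProjPartition s P)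

include hP

lemma sum_enorm_sq (v : H) : ∑ i ∈ s, ‖P i v‖ₑ ^ 2 = ‖v‖ₑ ^ 2 := by
  have h1 : ∀ i, ⟪v, P i v⟫_ℂ = ((‖P i v‖ ^ 2 : ℝ) : ℂ) := fun i => by
    have e : P i v = star (P i) (P i v) := by
      rw [hP.star_eq, ← mul_apply_eq_comp, hP.mul_self]
    conv_lhs => rw [e]
    rw [ContinuousLinearMap.star_eq_adjoint, ContinuousLinearMap.adjoint_inner_right,
      inner_self_eq_norm_sq_to_K]
    norm_cast
  have h2 : ((∑ i ∈ s, ‖P i v‖ ^ 2 : ℝ) : ℂ) = ((‖v‖ ^ 2 : ℝ) : ℂ) := by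
    calc ((∑ i ∈ s, ‖P i v‖ ^ 2 : ℝ) : ℂ) = ⟪v, (∑ i ∈ s, P i) v⟫_ℂ := by
          rw [sum_apply, inner_sum, Complex.ofReal_sum]
          exact Finset.sum_congr rfl fun i _ => (h1 i).symm
      _ = _ := by
          rw [hP.sum_eq_one, one_apply_eq_self, inner_self_eq_norm_sq_to_K]
          norm_cast
  have h3 := congrArg ENNReal.ofReal (Complex.ofReal_injective h2)
  rw [ENNReal.ofReal_sum_of_nonneg (fun _ _ => by positivity),
    ENNReal.ofReal_pow (norm_nonneg _), ofReal_norm] at h3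
  rw [← h3]
  exact Finset.sum_congr rfl fun i _ => by rw [ENNReal.ofReal_pow (norm_nonneg _), ofReal_norm]

lemma sum_hsNorm_sq_left (X : H →L[ℂ] H) : ∑ i ∈ s, hsNorm (P i * X) ^ 2 = hsNorm X ^ 2 := by
  simp_rw [hsNorm_sq (basis H), hsSum]
  rw [← Summable.tsum_finsetSum (fun i _ => ENNReal.summable)]
  exact tsum_congr fun k => hP.sum_enorm_sq _

lemma sum_hsNorm_sq_right (X : H →L[ℂ] H) : ∑ i ∈ s, hsNorm (X * P i) ^ 2 = hsNorm X ^ 2 := by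
  rw [← hsNorm_star X, ← hP.sum_hsNorm_sq_left]
  refine Finset.sum_congr rfl fun i _ => ?_
  rw [← hsNorm_star, star_mul, hP.star_eq]

lemma hsNorm_sq_eq (X : H →L[ℂ] H) :
    hsNorm X ^ 2 = ∑ i ∈ s, ∑ j ∈ s, hsNorm (P i * X * P j) ^ 2 := by
  rw [← hP.sum_hsNorm_sq_left X]
  exact Finset.sum_congr rfl fun i _ => (hP.sum_hsNorm_sq_right _).symm

lemma mul_sum (b : ι → ℂ) {i : ι} (hi : i ∈ s) : P i * ∑ k ∈ s, b k • P k = b i • P i := by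
  rw [Finset.mul_sum, Finset.sum_eq_single_of_mem i hi, mul_smul_comm, hP.mul_self]
  intro k _ hk
  rw [mul_smul_comm, hP.mul_eq_zero i k hk.symm, smul_zero]

lemma sum_mul (b : ι → ℂ) {i : ι} (hi : i ∈ s) : (∑ k ∈ s, b k • P k) * P i = b i • P i := by
  rw [Finset.sum_mul, Finset.sum_eq_single_of_mem i hi, smul_mul_assoc, hP.mul_self]
  intro k _ hk
  rw [smul_mul_assoc, hP.mul_eq_zero k i hk, smul_zero]

lemma compress_comm (b : ι → ℂ) (X : H →L[ℂ] H) {i j : ι} (hi : i ∈ s) (hj : j ∈ s) :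
    P i * comm (∑ k ∈ s, b k • P k) X * P j = (b i - b j) • (P i * X * P j) := by
  unfold comm
  rw [mul_sub, sub_mul, ← mul_assoc, hP.mul_sum b hi, mul_assoc (P i) (X * _), mul_assoc X,
    hP.sum_mul b hj, sub_smul]
  simp [mul_assoc]

/-- The Hilbert–Schmidt norm of a commutator with a diagonal operator is monotone in the distances
between the diagonal values: in block form, `[∑ b_k P_k, X]` has entries `(b_i - b_j) P_i X P_j`. -/
lemma hsNorm_comm_le_comm (a b : ι → ℂ) (X : H →L[ℂ] H)
    (h : ∀ i j, P i ≠ 0 → P j ≠ 0 → ‖b i - b j‖ ≤ ‖a i - a j‖) :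
    hsNorm (comm (∑ k ∈ s, b k • P k) X) ≤ hsNorm (comm (∑ k ∈ s, a k • P k) X) := by
  rw [← ENNReal.pow_le_pow_left_iff two_ne_zero, hP.hsNorm_sq_eq, hP.hsNorm_sq_eq (comm _ X)]
  refine Finset.sum_le_sum fun i hi => Finset.sum_le_sum fun j hj => ?_
  rw [hP.compress_comm b X hi hj, hP.compress_comm a X hi hj]
  by_cases hi0 : P i = 0
  · simp [hi0]
  by_cases hj0 : P j = 0
  · simp [hj0]
  rw [hsNorm_smul, hsNorm_smul]
  gcongr
  rw [← ofReal_norm, ← ofReal_norm]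
  exact ENNReal.ofReal_le_ofReal (h i j hi0 hj0)

end IsProjPartition

end Partition

/-! ### Multiplication operators and the square grid -/

section Multiplication

variable {Ω : Set ℂ}

lemma coeFn_mulOp (f : Lp ℂ ∞ (leb Ω)) (v : L2 Ω) :
    mulOp f v =ᵐ[leb Ω] fun z => f z * v z :=
  (ContinuousLinearMap.mul ℂ ℂ).coeFn_holder f v

/-- Multiplication by the indicator function of a Borel set. -/
def cutOff (Ω : Set ℂ) {s : Set ℂ} (hs : MeasurableSet s) : L2 Ω →L[ℂ] L2 Ω :=
  mulOp (MemLp.toLp (s.indicator fun _ => (1 : ℂ))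
    (memLp_top_of_bound (aestronglyMeasurable_const.indicator hs) 1
      (Eventually.of_forall fun z => by
        by_cases h : z ∈ s <;> simp [h])))

lemma coeFn_cutOff {s : Set ℂ} (hs : MeasurableSet s) (v : L2 Ω) :
    cutOff Ω hs v =ᵐ[leb Ω] s.indicator v := by
  filter_upwards [coeFn_mulOp _ v, MemLp.coeFn_toLp (memLp_top_of_bound (μ := leb Ω)
    (aestronglyMeasurable_const.indicator hs) 1 (Eventually.of_forall fun z => by
        by_cases h : z ∈ s <;> simp [h]) : MemLp (s.indicator fun _ => (1 : ℂ)) ∞ (leb Ω))]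
    with z h1 h2
  rw [cutOff, h1, h2]
  by_cases h : z ∈ s <;> simp [h]

lemma star_cutOff {s : Set ℂ} (hs : MeasurableSet s) : star (cutOff Ω hs) = cutOff Ω hs := by
  rw [ContinuousLinearMap.star_eq_adjoint, eq_comm, ContinuousLinearMap.eq_adjoint_iff]
  intro v w
  rw [MeasureTheory.L2.inner_def, MeasureTheory.L2.inner_def]
  refine integral_congr_ae ?_
  filter_upwards [coeFn_cutOff hs v, coeFn_cutOff hs w] with z h1 h2
  rw [h1, h2]
  by_cases h : z ∈ s <;> simp [h]

lemma cutOff_mul_self {s : Set ℂ} (hs : MeasurableSet s) :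
    cutOff Ω hs * cutOff Ω hs = cutOff Ω hs := by
  ext1 v
  refine Lp.ext ?_
  filter_upwards [coeFn_cutOff hs (cutOff Ω hs v), coeFn_cutOff hs v] with z h1 h2
  rw [mul_apply_eq_comp, h1]
  by_cases h : z ∈ s
  · simp [h]
  · simp [h, h2]

lemma cutOff_mul_eq_zero {s t : Set ℂ} (hs : MeasurableSet s) (ht : MeasurableSet t)
    (hst : Disjoint s t) : cutOff Ω hs * cutOff Ω ht = 0 := by
  ext1 v
  refine Lp.ext ?_
  filter_upwards [coeFn_cutOff hs (cutOff Ω ht v), coeFn_cutOff ht v,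
    Lp.coeFn_zero ℂ 2 (leb Ω)] with z h1 h2 h3
  rw [mul_apply_eq_comp, h1, zero_apply, h3]
  by_cases h : z ∈ s
  · simp [h, h2, Set.disjoint_left.1 hst h]
  · simp [h]

/-- The square of side `1/N` with index `m` in the square grid. -/
def cell (N : ℕ) (m : ℤ × ℤ) : Set ℂ := {z | ⌊N * z.re⌋ = m.1 ∧ ⌊N * z.im⌋ = m.2}

lemma measurableSet_cell (N : ℕ) (m : ℤ × ℤ) : MeasurableSet (cell N m) := by
  have h1 : Measurable fun z : ℂ => ⌊N * z.re⌋ :=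
    (Complex.measurable_re.const_mul _).floor
  have h2 : Measurable fun z : ℂ => ⌊N * z.im⌋ :=
    (Complex.measurable_im.const_mul _).floor
  exact (h1 (measurableSet_singleton m.1)).inter (h2 (measurableSet_singleton m.2))

lemma disjoint_cell {N : ℕ} {m m' : ℤ × ℤ} (h : m ≠ m') : Disjoint (cell N m) (cell N m') := by
  rw [Set.disjoint_left]
  rintro z ⟨h1, h2⟩ ⟨h3, h4⟩
  exact h (Prod.ext (h1.symm.trans h3) (h2.symm.trans h4))

lemma norm_sub_le_of_mem_cell {N : ℕ} (hN : 0 < N) {m : ℤ × ℤ} {z w : ℂ} (hz : z ∈ cell N m)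
    (hw : w ∈ cell N m) : ‖z - w‖ ≤ 2 / N := by
  have hN' : (0 : ℝ) < N := by exact_mod_cast hN
  have key : ∀ x y : ℝ, ⌊N * x⌋ = ⌊N * y⌋ → |x - y| ≤ 1 / N := fun x y h => by
    have := Int.abs_sub_lt_one_of_floor_eq_floor h
    rw [← mul_sub, abs_mul, abs_of_pos hN'] at this
    rw [le_div_iff₀ hN', mul_comm]
    exact this.le
  calc ‖z - w‖ ≤ |(z - w).re| + |(z - w).im| := Complex.norm_le_abs_re_add_abs_im _
    _ ≤ 1 / N + 1 / N := by
        rw [Complex.sub_re, Complex.sub_im]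
        exact add_le_add (key _ _ (hz.1.trans hw.1.symm)) (key _ _ (hz.2.trans hw.2.symm))
    _ = 2 / N := by ring

/-- The indices of the grid squares of side `1/N` that meet the disc of radius `R`. -/
def gridIndex (R N : ℕ) : Finset (ℤ × ℤ) :=
  Finset.Icc (-(R * N : ℤ)) (R * N) ×ˢ Finset.Icc (-(R * N : ℤ)) (R * N)

lemma mem_gridIndex {R : ℕ} (N : ℕ) {z : ℂ} (hz : ‖z‖ ≤ R) :
    (⌊N * z.re⌋, ⌊N * z.im⌋) ∈ gridIndex R N := by
  have key : ∀ x : ℝ, |x| ≤ R → ⌊N * x⌋ ∈ Finset.Icc (-(R * N : ℤ)) (R * N) := fun x hx => by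
    obtain ⟨h1, h2⟩ := abs_le.1 hx
    rw [Finset.mem_Icc, Int.le_floor]
    constructor
    · push_cast
      nlinarith [Nat.cast_nonneg (α := ℝ) N]
    · have : (⌊N * x⌋ : ℝ) ≤ (R * N : ℤ) := by
        refine (Int.floor_le _).trans ?_
        push_cast
        nlinarith [Nat.cast_nonneg (α := ℝ) N]
      exact_mod_cast this
  exact Finset.mem_product.2 ⟨key _ ((Complex.abs_re_le_norm z).trans hz),
    key _ ((Complex.abs_im_le_norm z).trans hz)⟩

lemma card_gridIndex_le (R : ℕ) {N : ℕ} (hN : 0 < N) :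
    (gridIndex R N).card ≤ ((2 * R + 1) * N) ^ 2 := by
  rw [gridIndex, Finset.card_product, Int.card_Icc, sq]
  have h : ((R * N : ℤ) + 1 - -(R * N : ℤ)).toNat ≤ (2 * R + 1) * N := by
    rw [Int.toNat_le]
    push_cast
    have : (1 : ℤ) ≤ N := by exact_mod_cast hN
    linarith
  exact Nat.mul_le_mul h h

/-- Multiplication by the indicator function of a square of the grid. -/
abbrev cellProj (Ω : Set ℂ) (N : ℕ) (m : ℤ × ℤ) : L2 Ω →L[ℂ] L2 Ω :=
  cutOff Ω (measurableSet_cell N m)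

lemma ae_norm_le {R : ℕ} (hΩ : MeasurableSet Ω) (hR : ∀ z ∈ Ω, ‖z‖ ≤ R) :
    ∀ᵐ z ∂leb Ω, ‖z‖ ≤ R :=
  (ae_restrict_iff' hΩ).2 (Eventually.of_forall hR)

lemma coeFn_sum_cellProj (s : Finset (ℤ × ℤ)) (N : ℕ) (b : ℤ × ℤ → ℂ) (v : L2 Ω) :
    (∑ m ∈ s, b m • cellProj Ω N m) v
      =ᵐ[leb Ω] fun z => ∑ m ∈ s, b m * (cell N m).indicator v z := by
  have h1 : ∀ᵐ z ∂leb Ω, ∀ m ∈ s, (b m • cellProj Ω N m v : L2 Ω) z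
      = b m * (cell N m).indicator v z := by
    rw [s.eventually_all]
    intro m _
    filter_upwards [Lp.coeFn_smul (b m) (cellProj Ω N m v),
      coeFn_cutOff (measurableSet_cell N m) v] with z h2 h3
    rw [h2, Pi.smul_apply, h3, smul_eq_mul]
  have h2 : (∑ m ∈ s, b m • cellProj Ω N m) v = ∑ m ∈ s, b m • cellProj Ω N m v := by
    simp [sum_apply]
  rw [h2]
  filter_upwards [Lp.coeFn_fun_finsetSum s fun m => b m • cellProj Ω N m v, h1] with z h3 h4
  rw [h3]
  exact Finset.sum_congr rfl h4

lemma sum_indicator_cell {R N : ℕ} (b : ℤ × ℤ → ℂ) (v : ℂ → ℂ) {z : ℂ} (hz : ‖z‖ ≤ R) :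
    ∑ m ∈ gridIndex R N, b m * (cell N m).indicator v z
      = b (⌊N * z.re⌋, ⌊N * z.im⌋) * v z := by
  rw [Finset.sum_eq_single_of_mem _ (mem_gridIndex N hz)]
  · rw [Set.indicator_of_mem]
    exact ⟨rfl, rfl⟩
  · intro m _ hm
    rw [Set.indicator_of_notMem, mul_zero]
    rintro ⟨h1, h2⟩
    exact hm (Prod.ext h1.symm h2.symm)

lemma isProjPartition_cellProj {R : ℕ} (hΩ : MeasurableSet Ω) (hR : ∀ z ∈ Ω, ‖z‖ ≤ R) (N : ℕ) :
    IsProjPartition (gridIndex R N) (cellProj Ω N) where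
  star_eq _ := star_cutOff _
  mul_self _ := cutOff_mul_self _
  mul_eq_zero _ _ h := cutOff_mul_eq_zero _ _ (disjoint_cell h)
  sum_eq_one := by
    ext1 v
    refine Lp.ext ?_
    filter_upwards [coeFn_sum_cellProj (gridIndex R N) N (fun _ => 1) v, ae_norm_le hΩ hR]
      with z h1 h2
    rw [sum_indicator_cell _ _ h2, one_mul] at h1
    simpa using h1

lemma norm_mulOp_sub_le {R : ℕ} (hΩ : MeasurableSet Ω) (hR : ∀ z ∈ Ω, ‖z‖ ≤ R) {N : ℕ}
    (f : Lp ℂ ∞ (leb Ω)) (b : ℤ × ℤ → ℂ) {δ : ℝ} (hδ : 0 ≤ δ)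
    (h : ∀ᵐ z ∂leb Ω, ∀ m, z ∈ cell N m → ‖f z - b m‖ ≤ δ) :
    ‖mulOp f - ∑ m ∈ gridIndex R N, b m • cellProj Ω N m‖ ≤ δ := by
  refine ContinuousLinearMap.opNorm_le_bound _ hδ fun v => Lp.norm_le_mul_norm_of_ae_le_mul ?_
  filter_upwards [coeFn_sum_cellProj (gridIndex R N) N b v, ae_norm_le hΩ hR, coeFn_mulOp f v,
    Lp.coeFn_sub (mulOp f v) ((∑ m ∈ gridIndex R N, b m • cellProj Ω N m) v), h]
    with z h1 h2 h3 h4 h5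
  rw [sub_apply, h4, Pi.sub_apply, h1, h3, sum_indicator_cell _ _ h2, ← sub_mul, norm_mul]
  gcongr
  exact h5 _ ⟨rfl, rfl⟩

/-! ### Commutators of Lipschitz functions with Hilbert–Schmidt operators -/

/-- An essentially Lipschitz function is Lipschitz on a set of full measure: the points `s` of the
support of the measure for which the Lipschitz estimate holds at almost every `t`. -/
lemma exists_lipschitz_set (f : Lp ℂ ∞ (leb Ω)) (hf : lipNorm f ≤ 1) :
    ∃ G : Set ℂ, (∀ᵐ z ∂leb Ω, z ∈ G) ∧ ∀ s ∈ G, ∀ t ∈ G, ‖f s - f t‖ ≤ ‖s - t‖ := by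
  have h1 : ∀ᵐ p ∂(leb Ω).prod (leb Ω), ‖f p.1 - f p.2‖ ≤ ‖p.1 - p.2‖ := by
    rw [lipNorm, eLpNorm_exponent_top] at hf
    filter_upwards [ae_le_eLpNormEssSup (f := diffQuot f) (μ := (leb Ω).prod (leb Ω))] with p hp
    have hp1 : ‖diffQuot f p‖ ≤ 1 := by
      have := hp.trans hf
      rwa [← ofReal_norm, ENNReal.ofReal_le_one] at this
    rcases eq_or_ne p.1 p.2 with he | he
    · simp [he]
    · rwa [diffQuot, norm_div, div_le_one (by simpa [sub_eq_zero] using he)] at hp1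
  have h2 : ∀ᵐ s ∂leb Ω, ∀ᵐ t ∂leb Ω, ‖f s - f t‖ ≤ ‖s - t‖ := Measure.ae_ae_of_ae_prod h1
  refine ⟨{s | s ∈ (leb Ω).support ∧ ∀ᵐ t ∂leb Ω, ‖f s - f t‖ ≤ ‖s - t‖}, ?_, ?_⟩
  · filter_upwards [h2, Measure.support_mem_ae (μ := leb Ω)] with s hs hs'
    exact ⟨hs', hs⟩
  · rintro s ⟨hs, hs'⟩ t ⟨-, ht'⟩
    refine le_of_forall_pos_le_add fun ε hε => ?_
    have hpos := (Measure.mem_support_iff_forall s).1 hs _ (Metric.ball_mem_nhds s (half_pos hε))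
    have hfreq : ∃ᵐ r ∂leb Ω, r ∈ Metric.ball s (ε / 2) := by
      rw [frequently_ae_mem_iff]
      exact hpos.ne'
    obtain ⟨r, hr, h3, h4⟩ := (hfreq.and_eventually (hs'.and ht')).exists
    rw [Metric.mem_ball, dist_eq_norm, norm_sub_rev] at hr
    calc ‖f s - f t‖ ≤ ‖f s - f r‖ + ‖f t - f r‖ := by
          rw [← norm_sub_rev (f r) (f t)]; exact norm_sub_le_norm_sub_add_norm_sub _ _ _
      _ ≤ ‖s - r‖ + ‖t - r‖ := add_le_add h3 h4
      _ ≤ ‖s - r‖ + (‖t - s‖ + ‖s - r‖) := by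
          gcongr; exact norm_sub_le_norm_sub_add_norm_sub _ _ _
      _ ≤ ‖s - t‖ + ε := by rw [norm_sub_rev t s]; linarith

lemma exists_nat_radius (hb : Bornology.IsBounded Ω) : ∃ R : ℕ, ∀ z ∈ Ω, ‖z‖ ≤ R := by
  obtain ⟨C, hC⟩ := hb.exists_norm_le
  obtain ⟨R, hR⟩ := exists_nat_ge C
  exact ⟨R, fun z hz => (hC z hz).trans hR⟩

lemma coeFn_coord (hΩ : MeasurableSet Ω) (hb : Bornology.IsBounded Ω) :
    (memLp_coord hΩ hb).toLp =ᵐ[leb Ω] fun z => z := MemLp.coeFn_toLp _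

lemma cutOff_eq_zero {s : Set ℂ} (hs : MeasurableSet s) (h : ∀ᵐ z ∂leb Ω, z ∉ s) :
    cutOff Ω hs = 0 := by
  ext1 v
  refine Lp.ext ?_
  filter_upwards [coeFn_cutOff hs v, h, Lp.coeFn_zero ℂ 2 (leb Ω)] with z h1 h2 h3
  rw [h1, zero_apply, h3, Set.indicator_of_notMem h2, Pi.zero_apply]

/-- For a Hilbert–Schmidt operator `X`, both multiplication operators are approximated in norm by
diagonal ones, with values at sample points of the grid squares. -/
lemma hsNorm_comm_mulOp_le_of_hs (hΩ : MeasurableSet Ω) (hb : Bornology.IsBounded Ω)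
    (f : Lp ℂ ∞ (leb Ω)) (hf : lipNorm f ≤ 1) (X : L2 Ω →L[ℂ] L2 Ω) (hX : hsNorm X < ∞) :
    hsNorm (comm (mulOp f) X) ≤ hsNorm (comm (opZ hΩ hb) X) := by
  classical
  obtain ⟨R, hR⟩ := exists_nat_radius hb
  obtain ⟨G, hG, hGf⟩ := exists_lipschitz_set f hf
  have main : ∀ N : ℕ, 0 < N → hsNorm (comm (mulOp f) X)
      ≤ hsNorm (comm (opZ hΩ hb) X) + ENNReal.ofReal (8 / N) * hsNorm X := fun N hN => by
    have hP := isProjPartition_cellProj hΩ hR N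
    -- Cells that miss `G` are null, so the value `0` chosen there plays no role.
    let a : ℤ × ℤ → ℂ := fun m => if h : (cell N m ∩ G).Nonempty then h.some else 0
    have ha : ∀ m, (cell N m ∩ G).Nonempty → a m ∈ cell N m ∩ G := fun m hm => by
      simp only [a, dif_pos hm]
      exact hm.some_mem
    have hne : ∀ m, cellProj Ω N m ≠ 0 → (cell N m ∩ G).Nonempty := fun m hm => by
      by_contra hcon
      refine hm (cutOff_eq_zero _ ?_)
      filter_upwards [hG] with z hz hz'
      exact hcon ⟨z, hz', hz⟩
    let fN := ∑ m ∈ gridIndex R N, f (a m) • cellProj Ω N m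
    let zN := ∑ m ∈ gridIndex R N, a m • cellProj Ω N m
    have hfN : ‖mulOp f - fN‖ ≤ 2 / N := by
      refine norm_mulOp_sub_le hΩ hR f (fun m => f (a m)) (by positivity) ?_
      filter_upwards [hG] with z hz m hm
      have := ha m ⟨z, hm, hz⟩
      exact (hGf _ hz _ this.2).trans (norm_sub_le_of_mem_cell hN hm this.1)
    have hzN : ‖opZ hΩ hb - zN‖ ≤ 2 / N := by
      refine norm_mulOp_sub_le hΩ hR _ a (by positivity) ?_
      filter_upwards [hG, coeFn_coord hΩ hb] with z hz hc m hm
      rw [hc]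
      exact norm_sub_le_of_mem_cell hN hm (ha m ⟨z, hm, hz⟩).1
    have hcomp : hsNorm (comm fN X) ≤ hsNorm (comm zN X) :=
      hP.hsNorm_comm_le_comm a (fun m => f (a m)) X fun i j hi hj =>
        hGf _ (ha i (hne i hi)).2 _ (ha j (hne j hj)).2
    have hsmall : ∀ D : L2 Ω →L[ℂ] L2 Ω, ‖D‖ ≤ 2 / N →
        hsNorm (comm D X) ≤ ENNReal.ofReal (4 / N) * hsNorm X := fun D hD => by
      refine (hsNorm_comm_le_ofReal hD X).trans_eq ?_
      congr 2
      ring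
    calc hsNorm (comm (mulOp f) X) = hsNorm (comm (mulOp f - fN) X + comm fN X) := by
          rw [comm_sub_left, sub_add_cancel]
      _ ≤ hsNorm (comm (mulOp f - fN) X) + hsNorm (comm fN X) := hsNorm_add_le _ _
      _ ≤ ENNReal.ofReal (4 / N) * hsNorm X + hsNorm (comm zN X) :=
          add_le_add (hsmall _ hfN) hcomp
      _ = ENNReal.ofReal (4 / N) * hsNorm X
          + hsNorm (comm (opZ hΩ hb) X - comm (opZ hΩ hb - zN) X) := by
          rw [comm_sub_left, sub_sub_cancel]
      _ ≤ ENNReal.ofReal (4 / N) * hsNorm X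
          + (hsNorm (comm (opZ hΩ hb) X) + ENNReal.ofReal (4 / N) * hsNorm X) := by
          gcongr
          exact (hsNorm_sub_le _ _).trans (by gcongr; exact hsmall _ hzN)
      _ = _ := by
          have : (8 / N : ℝ) = 4 / N + 4 / N := by ring
          rw [this, ENNReal.ofReal_add (by positivity) (by positivity)]
          ring
  have hlim : Tendsto (fun N : ℕ => hsNorm (comm (opZ hΩ hb) X)
      + ENNReal.ofReal (8 / N) * hsNorm X) atTop (𝓝 (hsNorm (comm (opZ hΩ hb) X) + 0)) := by
    refine Tendsto.const_add _ ?_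
    have h := ENNReal.Tendsto.mul_const (b := hsNorm X)
      (ENNReal.tendsto_ofReal (tendsto_const_div_atTop_nhds_zero_nat 8)) (Or.inr hX.ne)
    simpa using h
  rw [add_zero] at hlim
  refine ge_of_tendsto hlim ?_
  filter_upwards [eventually_gt_atTop 0] with N hN using main N hN

end Multiplication

/-! ### Almost commuting approximate units -/

section ApproximateUnit

set_option linter.unusedSectionVars false

variable {H : Type*} [NormedAddCommGroup H] [InnerProductSpace ℂ H] [CompleteSpace H]

lemma hsNorm_starProjection_sq (W : Submodule ℂ H) [FiniteDimensional ℂ W] :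
    hsNorm W.starProjection ^ 2 = Module.finrank ℂ W := by
  let w := stdOrthonormalBasis ℂ W
  have h1 : ∀ v : H, ‖W.starProjection v‖ₑ ^ 2 = ∑ k, ‖⟪(w k : H), v⟫_ℂ‖ₑ ^ 2 := fun v => by
    have h2 := w.sum_sq_norm_inner_right (W.orthogonalProjectionOnto v)
    have h3 : ∀ k, ⟪w k, W.orthogonalProjectionOnto v⟫_ℂ = ⟪(w k : H), v⟫_ℂ := fun k =>
      Submodule.inner_orthogonalProjectionOnto_eq_of_mem_left _ _
    simp_rw [h3] at h2
    have h4 := congrArg ENNReal.ofReal h2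
    rw [ENNReal.ofReal_sum_of_nonneg (fun _ _ => by positivity)] at h4
    simp_rw [ENNReal.ofReal_pow (norm_nonneg _), ofReal_norm] at h4
    rw [h4]
    rfl
  rw [hsNorm_sq (basis H), hsSum]
  simp_rw [h1]
  rw [Summable.tsum_finsetSum (fun i _ => ENNReal.summable)]
  have h5 : ∀ k, ∑' i, ‖⟪(w k : H), basis H i⟫_ℂ‖ₑ ^ 2 = 1 := fun k => by
    have h6 := parseval (basis H) (w k : H)
    have h7 : ‖(w k : H)‖ₑ = 1 := by
      rw [← ofReal_norm, ← Submodule.coe_norm, w.orthonormal.1, ENNReal.ofReal_one]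
    rw [h7, one_pow] at h6
    rw [← h6]
    refine tsum_congr fun i => ?_
    rw [← inner_conj_symm, ← ofReal_norm, RCLike.norm_conj, ofReal_norm]
  simp [h5]

lemma tendsto_trace_mul_zero {S : H →L[ℂ] H} (hS : hsNorm S < ∞) {X : ℕ → H →L[ℂ] H} {C : ℝ≥0∞}
    (hC : C < ∞) (hX : ∀ n, hsNorm (X n) ≤ C) (h0 : ∀ v, Tendsto (fun n => X n v) atTop (𝓝 0)) :
    Tendsto (fun n => trace (S * X n)) atTop (𝓝 0) := by
  have hfin : ∀ Y : H →L[ℂ] H, hsNorm Y < ∞ → ∀ n, traceNorm (Y * X n) < ∞ := fun Y hY n =>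
    (traceNorm_mul_le_hsNorm _ _).trans_lt
      (ENNReal.mul_lt_top hY ((hX n).trans_lt hC))
  have hproj : ∀ F : Finset (basisIndex H),
      Tendsto (fun n => trace (finProj F * S * X n)) atTop (𝓝 0) := fun F => by
    have e : ∀ n, trace (finProj F * S * X n) = ∑ i ∈ F, ⟪basis H i, S (X n (basis H i))⟫_ℂ :=
        fun n => by
      have h1 : traceDual (1 : H →L[ℂ] H) (∑ i ∈ F, C₁.rankOne (basis H i)
          (star (S * X n) (basis H i))) = trace (finProj F * S * X n) := by
        rw [traceDual_apply, one_mul, map_sum, mul_assoc, finProj_mul]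
        rfl
      rw [← h1, map_sum]
      refine Finset.sum_congr rfl fun i _ => ?_
      rw [traceDual_rankOne, one_apply_eq_self, ContinuousLinearMap.star_eq_adjoint,
        ContinuousLinearMap.adjoint_inner_left, mul_apply_eq_comp]
    simp_rw [e]
    rw [← Finset.sum_const_zero (s := F)]
    refine tendsto_finsetSum _ fun i _ => ?_
    have h2 := ((S.continuous.tendsto 0).comp (h0 (basis H i)))
    have h3 := Tendsto.inner (𝕜 := ℂ) (tendsto_const_nhds (x := basis H i)) h2
    simpa using h3
  have happrox := ENNReal.Tendsto.mul_const (b := C)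
    (tendsto_hsNorm_mul_sub norm_finProj_le tendsto_finProj hS) (Or.inr hC.ne)
  rw [zero_mul] at happrox
  rw [EMetric.tendsto_nhds]
  intro ε hε
  have hε2 : 0 < ε / 2 := ENNReal.half_pos hε.ne'
  obtain ⟨F, hF⟩ := ((tendsto_order.1 happrox).2 _ hε2).exists
  filter_upwards [EMetric.tendsto_nhds.1 (hproj F) (ε / 2) hε2] with n hn
  rw [edist_zero_right] at hn ⊢
  have hsub : trace (S * X n)
      = trace (finProj F * S * X n) - trace ((finProj F * S - S) * X n) := by
    have hFS : hsNorm (finProj F * S) < ∞ := (hsNorm_mul_left_le _ _).trans_lt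
      (ENNReal.mul_lt_top enorm_lt_top hS)
    rw [sub_mul, trace_sub (hfin _ hFS n) (hfin _ hS n), sub_sub_cancel]
  calc ‖trace (S * X n)‖ₑ
      ≤ ‖trace (finProj F * S * X n)‖ₑ + ‖trace ((finProj F * S - S) * X n)‖ₑ := by
        rw [hsub]; exact enorm_sub_le
    _ < ε / 2 + ε / 2 := by
        refine ENNReal.add_lt_add hn (lt_of_le_of_lt ?_ hF)
        refine (enorm_trace_le _).trans ((traceNorm_mul_le_hsNorm _ _).trans ?_)
        gcongr
        exact hX n
    _ = ε := ENNReal.add_halves ε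

/-- Mazur's trick: if the commutators `[Z, Eₙ]` of an approximate unit of Hilbert–Schmidt
contractions are bounded in `C₂`, they tend to `0` weakly in `C₂`, so that the commutators of
suitable convex combinations of the `Eₙ` tend to `0` in norm. -/
lemma exists_approxUnit_of_bounded (Z : H →L[ℂ] H) {E : ℕ → H →L[ℂ] H} {C : ℝ≥0∞} (hC : C < ∞)
    (hE : ∀ n, ‖E n‖ ≤ 1) (hE2 : ∀ n, hsNorm (E n) < ∞) (hcomm : ∀ n, hsNorm (comm Z (E n)) ≤ C)
    (hs : ∀ v, Tendsto (fun n => E n v) atTop (𝓝 v)) :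
    ∃ B : ℕ → H →L[ℂ] H, (∀ n, ‖B n‖ ≤ 1) ∧ (∀ n, hsNorm (B n) < ∞) ∧
      (∀ v, Tendsto (fun n => B n v) atTop (𝓝 v)) ∧
      Tendsto (fun n => hsNorm (comm Z (B n))) atTop (𝓝 0) := by
  have key : ∀ n : ℕ, ∀ ε : ℝ≥0∞, 0 < ε →
      ∃ A ∈ convexHull ℝ (E '' Set.Ici n), hsNorm (comm Z A) < ε := fun n ε hε => by
    let Y : Set (C₂ H) := {y | ∃ A ∈ convexHull ℝ (E '' Set.Ici n), (hsExtNorm H).incl y = comm Z A}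
    have hY : Convex ℝ Y := by
      rintro y ⟨A, hA, hy⟩ y' ⟨A', hA', hy'⟩ a b ha hb hab
      refine ⟨a • A + b • A', convex_convexHull ℝ _ hA hA' ha hb hab, ?_⟩
      have e : ∀ (c : ℝ) (x : C₂ H), c • x = (c : ℂ) • x := fun c x => rfl
      have e' : ∀ (c : ℝ) (x : H →L[ℂ] H), c • x = (c : ℂ) • x := fun c x => rfl
      rw [e, e, e', e', map_add, map_smul, map_smul, hy, hy', comm_add, comm_smul, comm_smul]
    have h0 : (0 : C₂ H) ∈ closure Y := by
      by_contra hcon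
      obtain ⟨f, u, hu, hf⟩ := RCLike.geometric_hahn_banach_point_closed (𝕜 := ℂ) hY.closure
        isClosed_closure hcon
      obtain ⟨S, rfl⟩ := exists_hsDual_eq f
      have hlim := tendsto_trace_mul_zero ((hsExtNorm H).incl_lt_top S) hC hcomm fun v => by
        have h1 := ((Z.continuous.tendsto v).comp (hs v)).sub (hs (Z v))
        rw [sub_self] at h1
        exact h1
      have hre := (Complex.continuous_re.tendsto 0).comp hlim
      rw [map_zero, Complex.zero_re] at *
      refine absurd (ge_of_tendsto hre ?_) (not_le.2 hu)
      filter_upwards [eventually_ge_atTop n] with k hk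
      have := hf ((hsExtNorm H).ofFinite (comm Z (E k)) ((hcomm k).trans_lt hC))
        (subset_closure ⟨E k, subset_convexHull ℝ _ ⟨k, hk, rfl⟩, rfl⟩)
      exact this.le
    obtain ⟨y, ⟨A, hA, hy⟩, hyε⟩ := EMetric.mem_closure_iff.1 h0 ε hε
    refine ⟨A, hA, ?_⟩
    rw [edist_comm, edist_zero_right, (hsExtNorm H).enorm_def, hy] at hyε
    exact hyε
  have hpos : ∀ n : ℕ, (0 : ℝ≥0∞) < ((n : ℝ≥0∞))⁻¹ := fun n => by simp
  choose B hB hBε using fun n : ℕ => key n _ (hpos n)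
  refine ⟨B, fun n => ?_, fun n => ?_, fun v => ?_, ?_⟩
  · have h : convexHull ℝ (E '' Set.Ici n) ⊆ Metric.closedBall 0 1 :=
      convexHull_min (by rintro _ ⟨k, -, rfl⟩; simpa using hE k) (convex_closedBall 0 1)
    simpa using h (hB n)
  · have h : convexHull ℝ (E '' Set.Ici n) ⊆
        (((hsExtNorm H).finite.restrictScalars ℝ : Submodule ℝ (H →L[ℂ] H)) : Set (H →L[ℂ] H)) :=
      convexHull_min (by rintro _ ⟨k, -, rfl⟩; exact hE2 k) (Submodule.convex _)
    exact h (hB n)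
  · rw [Metric.tendsto_atTop]
    intro ε hε
    obtain ⟨n₀, hn₀⟩ := Metric.tendsto_atTop.1 (hs v) ε hε
    refine ⟨n₀, fun n hn => ?_⟩
    have h : convexHull ℝ (E '' Set.Ici n) ⊆
        (ContinuousLinearMap.apply ℂ H v).toLinearMap.restrictScalars ℝ ⁻¹' Metric.ball v ε :=
      convexHull_min (by
        rintro _ ⟨k, hk, rfl⟩
        exact hn₀ k (hn.trans hk)) ((convex_ball v ε).linear_preimage _)
    exact h (hB n)
  · exact tendsto_of_tendsto_of_tendsto_of_le_of_le tendsto_const_nhds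
      ENNReal.tendsto_inv_nat_nhds_zero (fun _ => zero_le) fun n => (hBε n).le

/-- The Hilbert–Schmidt norm is lower semicontinuous for strong convergence. -/
lemma hsNorm_le_of_tendsto {X : ℕ → H →L[ℂ] H} {Y : H →L[ℂ] H} {c : ℕ → ℝ≥0∞} {C : ℝ≥0∞}
    (hX : ∀ v, Tendsto (fun n => X n v) atTop (𝓝 (Y v))) (hc : ∀ n, hsNorm (X n) ≤ c n)
    (hlim : Tendsto c atTop (𝓝 C)) : hsNorm Y ≤ C := by
  rw [hsNorm_le_iff, hsSum, ENNReal.tsum_eq_iSup_sum]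
  refine iSup_le fun F => ?_
  have h1 : Tendsto (fun n => ∑ i ∈ F, ‖X n (basis H i)‖ₑ ^ 2) atTop
      (𝓝 (∑ i ∈ F, ‖Y (basis H i)‖ₑ ^ 2)) :=
    tendsto_finsetSum _ fun i _ => ENNReal.Tendsto.pow ((continuous_enorm.tendsto _).comp (hX _))
  refine le_of_tendsto_of_tendsto' h1 (ENNReal.Tendsto.pow hlim) fun n => ?_
  exact (ENNReal.sum_le_tsum F).trans (hsNorm_le_iff.1 (hc n))

/-- The trace of a trace-class commutator `[Z, X]` vanishes if `X` is Hilbert–Schmidt and `Z` almost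
commutes with an approximate unit: `Tr (B [Z, X]) = Tr ([B, Z] X)` is small. -/
lemma trace_comm_eq_zero_of_approxUnit {Z : H →L[ℂ] H} {B : ℕ → H →L[ℂ] H}
    (hB : ∀ n, ‖B n‖ ≤ 1) (hB2 : ∀ n, hsNorm (B n) < ∞)
    (hs : ∀ v, Tendsto (fun n => B n v) atTop (𝓝 v))
    (hcomm : Tendsto (fun n => hsNorm (comm Z (B n))) atTop (𝓝 0)) {X : H →L[ℂ] H}
    (hX : hsNorm X < ∞) (hZX : traceNorm (comm Z X) < ∞) : trace (comm Z X) = 0 := by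
  have h1 : ∀ n, trace (B n * comm Z X) = -trace (comm Z (B n) * X) := fun n => by
    have hBX : traceNorm (B n * X) < ∞ := (traceNorm_mul_le_hsNorm _ _).trans_lt
      (ENNReal.mul_lt_top (hB2 n) hX)
    have hBZX : traceNorm (B n * (Z * X)) < ∞ := (traceNorm_mul_le_hsNorm _ _).trans_lt
      (ENNReal.mul_lt_top (hB2 n) ((hsNorm_mul_left_le _ _).trans_lt
        (ENNReal.mul_lt_top enorm_lt_top hX)))
    have hBXZ : traceNorm (B n * X * Z) < ∞ := (traceNorm_mul_right_le _ _).trans_lt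
      (ENNReal.mul_lt_top hBX enorm_lt_top)
    have hZBX : traceNorm (Z * (B n * X)) < ∞ := (traceNorm_mul_left_le _ _).trans_lt
      (ENNReal.mul_lt_top enorm_lt_top hBX)
    unfold comm
    rw [mul_sub, sub_mul, ← mul_assoc (B n) X Z, trace_sub hBZX hBXZ, mul_assoc Z,
      mul_assoc (B n) Z X, trace_sub hZBX hBZX, trace_mul_comm Z hBX]
    ring
  have h2 : Tendsto (fun n => ‖trace (B n * comm Z X)‖ₑ) atTop (𝓝 0) := by
    have h3 := ENNReal.Tendsto.mul_const (b := hsNorm X) hcomm (Or.inr hX.ne)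
    rw [zero_mul] at h3
    refine tendsto_of_tendsto_of_tendsto_of_le_of_le tendsto_const_nhds h3
      (fun _ => zero_le) fun n => ?_
    simp only [h1, enorm_neg]
    exact (enorm_trace_le _).trans (traceNorm_mul_le_hsNorm _ _)
  have h4 := (tendsto_traceNorm_mul_sub hB hs hZX).add h2
  rw [add_zero] at h4
  have h5 : ‖trace (comm Z X)‖ₑ ≤ 0 := by
    refine ge_of_tendsto' h4 fun n => ?_
    have hBc : traceNorm (B n * comm Z X) < ∞ := (traceNorm_mul_left_le _ _).trans_lt
      (ENNReal.mul_lt_top enorm_lt_top hZX)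
    have e : trace (comm Z X)
        = trace (B n * comm Z X) - trace (B n * comm Z X - comm Z X) := by
      rw [trace_sub hBc hZX, sub_sub_cancel]
    calc ‖trace (comm Z X)‖ₑ
        ≤ ‖trace (B n * comm Z X)‖ₑ + ‖trace (B n * comm Z X - comm Z X)‖ₑ := by
          conv_lhs => rw [e]
          exact enorm_sub_le
      _ ≤ _ := by
          rw [add_comm]
          gcongr
          exact enorm_trace_le _
  simpa using h5

end ApproximateUnit

/-! ### Step functions on the square grid -/

section StepFunctions

variable {Ω : Set ℂ}

lemma isFiniteMeasure_leb (hb : Bornology.IsBounded Ω) : IsFiniteMeasure (leb Ω) :=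
  ⟨by simpa using hb.measure_lt_top⟩

/-- The constant function `1` in `L²(Ω, λ)`. -/
def oneL2 (hb : Bornology.IsBounded Ω) : L2 Ω :=
  haveI := isFiniteMeasure_leb hb
  (memLp_const (1 : ℂ) : MemLp (fun _ : ℂ => (1 : ℂ)) 2 (leb Ω)).toLp

lemma coeFn_oneL2 (hb : Bornology.IsBounded Ω) : oneL2 hb =ᵐ[leb Ω] fun _ => 1 := by
  have := isFiniteMeasure_leb hb
  exact MemLp.coeFn_toLp _

/-- The functions in `L²(Ω, λ)` that are constant on the grid squares of side `1/N`, for `Ω` in the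
disc of radius `R`. -/
def stepSpace (hb : Bornology.IsBounded Ω) (R N : ℕ) : Submodule ℂ (L2 Ω) :=
  Submodule.span ℂ ((fun m => cellProj Ω N m (oneL2 hb)) '' (gridIndex R N : Set (ℤ × ℤ)))

instance (hb : Bornology.IsBounded Ω) (R N : ℕ) : FiniteDimensional ℂ (stepSpace hb R N) :=
  FiniteDimensional.span_of_finite _ ((gridIndex R N).finite_toSet.image _)

lemma finrank_stepSpace_le (hb : Bornology.IsBounded Ω) (R : ℕ) {N : ℕ} (hN : 0 < N) :
    Module.finrank ℂ (stepSpace hb R N) ≤ ((2 * R + 1) * N) ^ 2 := by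
  classical
  rw [stepSpace, ← Finset.coe_image]
  refine (finrank_span_finset_le_card _).trans (Finset.card_image_le.trans ?_)
  exact card_gridIndex_le R hN

lemma cellProj_one_mem (hb : Bornology.IsBounded Ω) {R N : ℕ} {m : ℤ × ℤ}
    (hm : m ∈ gridIndex R N) : cellProj Ω N m (oneL2 hb) ∈ stepSpace hb R N :=
  Submodule.subset_span ⟨m, hm, rfl⟩

lemma cellProj_mem_stepSpace (hb : Bornology.IsBounded Ω) {R N : ℕ} (m : ℤ × ℤ) {v : L2 Ω}
    (hv : v ∈ stepSpace hb R N) : cellProj Ω N m v ∈ stepSpace hb R N := by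
  refine Submodule.span_induction (p := fun w _ => cellProj Ω N m w ∈ stepSpace hb R N)
    ?_ ?_ ?_ ?_ hv
  · rintro _ ⟨k, hk, rfl⟩
    have e : cellProj Ω N m (cellProj Ω N k (oneL2 hb))
        = (cellProj Ω N m * cellProj Ω N k) (oneL2 hb) := (mul_apply_eq_comp _ _ _).symm
    rw [e]
    by_cases hmk : m = k
    · subst hmk
      rw [cutOff_mul_self]
      exact cellProj_one_mem hb hk
    · rw [cutOff_mul_eq_zero _ _ (disjoint_cell hmk), zero_apply]
      exact Submodule.zero_mem _
  · rw [map_zero]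
    exact Submodule.zero_mem _
  · intro x y _ _ hx hy
    rw [map_add]
    exact Submodule.add_mem _ hx hy
  · intro c x _ hx
    rw [map_smul]
    exact Submodule.smul_mem _ c hx

/-- The projection of `L²(Ω, λ)` onto the step functions: averaging over the grid squares. -/
abbrev stepProj (hb : Bornology.IsBounded Ω) (R N : ℕ) : L2 Ω →L[ℂ] L2 Ω :=
  (stepSpace hb R N).starProjection

lemma stepProj_mul_cellProj (hb : Bornology.IsBounded Ω) (R N : ℕ) (m : ℤ × ℤ) :
    cellProj Ω N m * stepProj hb R N = stepProj hb R N * cellProj Ω N m := by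
  ext1 v
  symm
  refine Submodule.eq_starProjection_of_mem_of_inner_eq_zero (K := stepSpace hb R N)
    (cellProj_mem_stepSpace hb m (Submodule.starProjection_apply_mem _ v)) fun w hw => ?_
  have h := Submodule.starProjection_inner_eq_zero v (cellProj Ω N m w)
    (cellProj_mem_stepSpace hb m hw)
  have h2 : ⟪cellProj Ω N m (v - stepProj hb R N v), w⟫_ℂ = 0 := by
    have e := ContinuousLinearMap.adjoint_inner_right (cellProj Ω N m)
      (v - stepProj hb R N v) w
    rw [← ContinuousLinearMap.star_eq_adjoint, star_cutOff] at e
    exact e.symm.trans h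
  rwa [map_sub] at h2

lemma hsNorm_stepProj_le (hb : Bornology.IsBounded Ω) (R : ℕ) {N : ℕ} (hN : 0 < N) :
    hsNorm (stepProj hb R N) ≤ ((2 * R + 1) * N : ℕ) := by
  rw [← ENNReal.pow_le_pow_left_iff two_ne_zero, hsNorm_starProjection_sq]
  exact_mod_cast finrank_stepSpace_le hb R hN

/-- The corner of a grid square. -/
def corner (N : ℕ) (m : ℤ × ℤ) : ℂ := ⟨m.1 / N, m.2 / N⟩

lemma corner_mem_cell {N : ℕ} (hN : 0 < N) (m : ℤ × ℤ) : corner N m ∈ cell N m := by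
  have hN' : (N : ℝ) ≠ 0 := by exact_mod_cast hN.ne'
  constructor <;> simp [corner, mul_div_cancel₀ _ hN']

/-- The commutators of `Z` with the averaging projections are bounded in the Hilbert–Schmidt norm:
`Z` differs from a diagonal operator, which commutes with the projection, by `O(1/N)`, and the
projection has rank `O(N²)`. -/
lemma hsNorm_comm_stepProj_le (hΩ : MeasurableSet Ω) (hb : Bornology.IsBounded Ω) {R : ℕ}
    (hR : ∀ z ∈ Ω, ‖z‖ ≤ R) {N : ℕ} (hN : 0 < N) :
    hsNorm (comm (opZ hΩ hb) (stepProj hb R N)) ≤ ENNReal.ofReal (4 * (2 * R + 1)) := by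
  let zN := ∑ m ∈ gridIndex R N, corner N m • cellProj Ω N m
  have hzN : ‖opZ hΩ hb - zN‖ ≤ 2 / N := by
    refine norm_mulOp_sub_le hΩ hR _ (corner N) (by positivity) ?_
    filter_upwards [coeFn_coord hΩ hb] with z hz m hm
    rw [hz]
    exact norm_sub_le_of_mem_cell hN hm (corner_mem_cell hN m)
  have hcomm : comm zN (stepProj hb R N) = 0 := by
    unfold comm
    simp only [zN]
    rw [Finset.sum_mul, Finset.mul_sum, sub_eq_zero]
    refine Finset.sum_congr rfl fun m _ => ?_
    rw [smul_mul_assoc, mul_smul_comm, stepProj_mul_cellProj]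
  have hN' : (0 : ℝ) < N := by exact_mod_cast hN
  calc hsNorm (comm (opZ hΩ hb) (stepProj hb R N))
      = hsNorm (comm (opZ hΩ hb - zN) (stepProj hb R N)) := by
        rw [comm_sub_left, hcomm, sub_zero]
    _ ≤ ENNReal.ofReal (2 * (2 / N)) * hsNorm (stepProj hb R N) := hsNorm_comm_le_ofReal hzN _
    _ ≤ ENNReal.ofReal (2 * (2 / N)) * ENNReal.ofReal (((2 * R + 1) * N : ℕ) : ℝ) := by
        gcongr
        rw [ENNReal.ofReal_natCast]
        exact hsNorm_stepProj_le hb R hN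
    _ = ENNReal.ofReal (4 * (2 * R + 1)) := by
        rw [← ENNReal.ofReal_mul (by positivity)]
        congr 1
        push_cast
        field_simp
        ring

lemma sum_cellProj_one_mem (hb : Bornology.IsBounded Ω) {R N : ℕ} (b : ℤ × ℤ → ℂ) :
    (∑ m ∈ gridIndex R N, b m • cellProj Ω N m) (oneL2 hb) ∈ stepSpace hb R N := by
  rw [sum_apply]
  exact Submodule.sum_mem _ fun m hm => Submodule.smul_mem _ _ (cellProj_one_mem hb hm)

/-- Continuous functions with compact support are dense in `L²`, and step functions approximate
them uniformly. -/
lemma tendsto_stepProj (hΩ : MeasurableSet Ω) (hb : Bornology.IsBounded Ω) {R : ℕ}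
    (hR : ∀ z ∈ Ω, ‖z‖ ≤ R) (v : L2 Ω) :
    Tendsto (fun N => stepProj hb R N v) atTop (𝓝 v) := by
  have := isFiniteMeasure_leb hb
  rw [Metric.tendsto_atTop]
  intro ε hε
  obtain ⟨g, hgs, hgv, hgc, hg2⟩ := (Lp.memLp v).exists_hasCompactSupport_eLpNorm_sub_le
    (by norm_num) (ε := ENNReal.ofReal (ε / 8)) (by simpa using hε)
  obtain ⟨M, hM⟩ := hgs.exists_bound_of_continuous hgc
  have hginf : MemLp g ∞ (leb Ω) := memLp_top_of_bound hgc.aestronglyMeasurable M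
    (Eventually.of_forall hM)
  have hgu : UniformContinuous g := hgs.uniformContinuous_of_continuous hgc
  let η : ℝ := ε / (8 * (‖oneL2 hb‖ + 1))
  have hη : 0 < η := by positivity
  obtain ⟨δ, hδ, hgδ⟩ := Metric.uniformContinuous_iff.1 hgu η hη
  obtain ⟨N₀, hN₀⟩ := exists_nat_gt (2 / δ)
  refine ⟨N₀, fun N hN => ?_⟩
  have hNpos : (0 : ℝ) < N := (div_pos two_pos hδ).trans (hN₀.trans_le (by exact_mod_cast hN))
  have hN1 : 0 < N := by exact_mod_cast hNpos
  have hNδ : 2 / (N : ℝ) < δ := by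
    rw [div_lt_comm₀ hNpos hδ]
    exact hN₀.trans_le (by exact_mod_cast hN)
  let gL : L2 Ω := mulOp hginf.toLp (oneL2 hb)
  have hgL : gL =ᵐ[leb Ω] g := by
    filter_upwards [coeFn_mulOp hginf.toLp (oneL2 hb), coeFn_oneL2 hb, hginf.coeFn_toLp]
      with z h1 h2 h3
    rw [h1, h2, h3, mul_one]
  have h1 : ‖v - gL‖ ≤ ε / 8 := by
    rw [Lp.norm_def]
    refine ENNReal.toReal_le_of_le_ofReal (by positivity) (le_trans (le_of_eq ?_) hgv)
    refine eLpNorm_congr_ae ?_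
    filter_upwards [Lp.coeFn_sub v gL, hgL] with z h2 h3
    rw [h2, Pi.sub_apply, Pi.sub_apply, h3]
  let D := ∑ m ∈ gridIndex R N, g (corner N m) • cellProj Ω N m
  have h2 : ‖mulOp hginf.toLp - D‖ ≤ η := by
    refine norm_mulOp_sub_le hΩ hR _ (fun m => g (corner N m)) hη.le ?_
    filter_upwards [hginf.coeFn_toLp] with z hz m hm
    rw [hz, ← dist_eq_norm]
    refine (hgδ ?_).le
    rw [dist_eq_norm]
    exact (norm_sub_le_of_mem_cell hN1 hm (corner_mem_cell hN1 m)).trans_lt hNδ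
  let w : L2 Ω := D (oneL2 hb)
  have h3 : ‖gL - w‖ ≤ ε / 8 := by
    calc ‖gL - w‖ = ‖(mulOp hginf.toLp - D) (oneL2 hb)‖ := by rw [sub_apply]
      _ ≤ η * ‖oneL2 hb‖ := ContinuousLinearMap.le_of_opNorm_le _ h2 _
      _ ≤ η * (‖oneL2 hb‖ + 1) := by gcongr; linarith
      _ = ε / 8 := by
          simp only [η]
          field_simp
  have hw : stepProj hb R N w = w :=
    Submodule.starProjection_eq_self_iff.2 (sum_cellProj_one_mem hb _)
  have h4 : ‖v - w‖ ≤ ε / 4 := by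
    calc ‖v - w‖ ≤ ‖v - gL‖ + ‖gL - w‖ := norm_sub_le_norm_sub_add_norm_sub _ _ _
      _ ≤ ε / 8 + ε / 8 := add_le_add h1 h3
      _ = ε / 4 := by ring
  calc dist (stepProj hb R N v) v = ‖stepProj hb R N (v - w) - (v - w)‖ := by
        rw [dist_eq_norm, map_sub, hw]
        congr 1
        abel
    _ ≤ ‖stepProj hb R N (v - w)‖ + ‖v - w‖ := norm_sub_le _ _
    _ ≤ 1 * ‖v - w‖ + ‖v - w‖ := by
        gcongr
        exact ContinuousLinearMap.le_of_opNorm_le _ (Submodule.starProjection_norm_le _) _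
    _ < ε := by linarith

lemma exists_approxUnit_opZ (hΩ : MeasurableSet Ω) (hb : Bornology.IsBounded Ω) :
    ∃ B : ℕ → L2 Ω →L[ℂ] L2 Ω, (∀ n, ‖B n‖ ≤ 1) ∧ (∀ n, hsNorm (B n) < ∞) ∧
      (∀ v, Tendsto (fun n => B n v) atTop (𝓝 v)) ∧
      Tendsto (fun n => hsNorm (comm (opZ hΩ hb) (B n))) atTop (𝓝 0) := by
  obtain ⟨R, hR⟩ := exists_nat_radius hb
  -- The index is shifted because the grid of side `1 / n` makes sense only for `n > 0`.
  refine exists_approxUnit_of_bounded (opZ hΩ hb) (E := fun n => stepProj hb R (n + 1))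
    (C := ENNReal.ofReal (4 * (2 * R + 1))) ENNReal.ofReal_lt_top
    (fun n => Submodule.starProjection_norm_le _)
    (fun n => (hsNorm_stepProj_le hb R n.succ_pos).trans_lt (ENNReal.natCast_lt_top _))
    (fun n => hsNorm_comm_stepProj_le hΩ hb hR n.succ_pos)
    (fun v => (tendsto_stepProj hΩ hb hR v).comp (tendsto_add_atTop_nat 1))

/-! ### The Lipschitz constant as a Hilbert–Schmidt norm -/

lemma measurable_diffQuot (f : Lp ℂ ∞ (leb Ω)) : Measurable (diffQuot f) := by
  have hf : Measurable f := (Lp.stronglyMeasurable f).measurable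
  exact ((hf.comp measurable_fst).sub (hf.comp measurable_snd)).div
    (measurable_fst.sub measurable_snd)

lemma lipNorm_coord_le (hΩ : MeasurableSet Ω) (hb : Bornology.IsBounded Ω) :
    lipNorm (memLp_coord hΩ hb).toLp ≤ 1 := by
  have := isFiniteMeasure_leb hb
  rw [lipNorm, eLpNorm_exponent_top]
  refine eLpNormEssSup_le_of_ae_enorm_bound ?_
  have h := coeFn_coord hΩ hb
  filter_upwards [Measure.quasiMeasurePreserving_fst.ae h,
    Measure.quasiMeasurePreserving_snd.ae h] with p h1 h2
  rw [diffQuot, h1, h2]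
  rcases eq_or_ne (p.1 - p.2) 0 with h0 | h0
  · simp [h0]
  · simp [div_self h0]

lemma mem_Lam_of_lipNorm_le {f : Lp ℂ ∞ (leb Ω)} (hf : lipNorm f ≤ 1) : f ∈ Lam Ω :=
  ⟨(measurable_diffQuot f).aestronglyMeasurable, hf.trans_lt ENNReal.one_lt_top⟩

lemma hsNorm_comm_mulOp_le (hΩ : MeasurableSet Ω) (hb : Bornology.IsBounded Ω)
    (f : Lp ℂ ∞ (leb Ω)) (hf : lipNorm f ≤ 1) (T : L2 Ω →L[ℂ] L2 Ω) :
    hsNorm (comm (mulOp f) T) ≤ hsNorm (comm (opZ hΩ hb) T) := by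
  obtain ⟨B, hB, hB2, hs, hcomm⟩ := exists_approxUnit_opZ hΩ hb
  have hX : ∀ v, Tendsto (fun n => comm (mulOp f) (B n * T) v) atTop
      (𝓝 (comm (mulOp f) T v)) := fun v => by
    have h1 := (((mulOp f).continuous.tendsto _).comp (hs (T v))).sub (hs (T (mulOp f v)))
    exact h1
  have hlim : Tendsto (fun n => hsNorm (comm (opZ hΩ hb) (B n)) * ‖T‖ₑ
      + hsNorm (comm (opZ hΩ hb) T)) atTop (𝓝 (0 * ‖T‖ₑ + hsNorm (comm (opZ hΩ hb) T))) :=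
    (ENNReal.Tendsto.mul_const hcomm (Or.inr enorm_ne_top)).add_const _
  rw [zero_mul, zero_add] at hlim
  refine hsNorm_le_of_tendsto hX (fun n => ?_) hlim
  have hBT : hsNorm (B n * T) < ∞ := (hsNorm_mul_right_le _ _).trans_lt
    (ENNReal.mul_lt_top (hB2 n) enorm_lt_top)
  refine (hsNorm_comm_mulOp_le_of_hs hΩ hb f hf _ hBT).trans ?_
  rw [comm_mul]
  refine (hsNorm_add_le _ _).trans (add_le_add (hsNorm_mul_right_le _ _) ?_)
  refine (hsNorm_mul_left_le _ _).trans ?_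
  have h1 : ‖B n‖ₑ ≤ 1 := by
    rw [← ofReal_norm, ENNReal.ofReal_le_one]
    exact hB n
  exact (mul_le_mul_left h1 _).trans_eq (one_mul _)

/-- Among all `1`-Lipschitz functions, the coordinate function has the largest commutator with a
given operator. -/
theorem lipConst_eq (hΩ : MeasurableSet Ω) (hb : Bornology.IsBounded Ω) (T : L2 Ω →L[ℂ] L2 Ω) :
    lipConst T = hsNorm (comm (opZ hΩ hb) T) := by
  refine le_antisymm (iSup₂_le fun f hf => hsNorm_comm_mulOp_le hΩ hb f hf.2 T) ?_
  have h := lipNorm_coord_le hΩ hb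
  exact le_iSup₂ (f := fun (f : Lp ℂ ∞ (leb Ω))
    (_ : f ∈ {f : Lp ℂ ∞ (leb Ω) | f ∈ Lam Ω ∧ lipNorm f ≤ 1}) => hsNorm (comm (mulOp f) T))
    (memLp_coord hΩ hb).toLp ⟨mem_Lam_of_lipNorm_le h, h⟩

lemma trace_comm_opZ_eq_zero (hΩ : MeasurableSet Ω) (hb : Bornology.IsBounded Ω)
    {X : L2 Ω →L[ℂ] L2 Ω} (hX : hsNorm X < ∞) (hZX : traceNorm (comm (opZ hΩ hb) X) < ∞) :
    trace (comm (opZ hΩ hb) X) = 0 := by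
  obtain ⟨B, hB, hB2, hs, hcomm⟩ := exists_approxUnit_opZ hΩ hb
  exact trace_comm_eq_zero_of_approxUnit hB hB2 hs hcomm hX hZX

end StepFunctions

/-! ### Functionals on products and quotients -/

section Functionals

variable {E F : Type*} [NormedAddCommGroup E] [NormedSpace ℂ E] [NormedAddCommGroup F]
  [NormedSpace ℂ F]

lemma exists_le_re_apply {f : StrongDual ℂ E} {a : ℝ} (ha : a < ‖f‖) :
    ∃ x, ‖x‖ ≤ 1 ∧ a < (f x).re := by
  obtain ⟨x, hx, hax⟩ := f.exists_lt_apply_of_lt_opNorm ha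
  rcases eq_or_ne (f x) 0 with h0 | h0
  · exact ⟨0, by simp, by simpa [h0] using hax⟩
  refine ⟨((starRingEnd ℂ (f x)) / ‖f x‖) • x, ?_, ?_⟩
  · rw [norm_smul, norm_div, RCLike.norm_conj, Complex.norm_real, norm_norm,
      div_self (norm_ne_zero_iff.2 h0), one_mul]
    exact hx.le
  · have h1 : (‖f x‖ : ℂ) ≠ 0 := by simpa using h0
    have e : f (((starRingEnd ℂ (f x)) / ‖f x‖) • x) = (‖f x‖ : ℂ) := by
      rw [map_smul, smul_eq_mul, div_mul_eq_mul_div, Complex.conj_mul']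
      field_simp
    rw [e, Complex.ofReal_re]
    exact hax

/-- The dual norm of the maximum norm on a product is the sum of the dual norms. -/
lemma norm_coprod_eq_add (f : StrongDual ℂ E) (g : StrongDual ℂ F) :
    ‖f.coprod g‖ = ‖f‖ + ‖g‖ := by
  refine le_antisymm ?_ ?_
  · refine ContinuousLinearMap.opNorm_le_bound _ (by positivity) fun p => ?_
    rw [ContinuousLinearMap.coprod_apply, add_mul]
    exact (norm_add_le _ _).trans (add_le_add (f.le_of_opNorm_le_of_le le_rfl (norm_fst_le p))
      (g.le_of_opNorm_le_of_le le_rfl (norm_snd_le p)))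
  · refine le_of_forall_pos_lt_add fun ε hε => ?_
    obtain ⟨x, hx, hfx⟩ := exists_le_re_apply (f := f) (a := ‖f‖ - ε / 2) (by linarith)
    obtain ⟨y, hy, hgy⟩ := exists_le_re_apply (f := g) (a := ‖g‖ - ε / 2) (by linarith)
    have h1 : ‖f.coprod g (x, y)‖ ≤ ‖f.coprod g‖ * 1 :=
      ContinuousLinearMap.le_of_opNorm_le_of_le _ le_rfl (max_le hx hy)
    have h2 : (f.coprod g (x, y)).re ≤ ‖f.coprod g (x, y)‖ := Complex.re_le_norm _
    have h3 : (f.coprod g (x, y)).re = (f x).re + (g y).re := Complex.add_re _ _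
    linarith

lemma norm_liftQL {S : Submodule ℂ E} (f : StrongDual ℂ E) (h : S ≤ f.ker) :
    ‖S.liftQL f h‖ = ‖f‖ := by
  refine le_antisymm ?_ ?_
  · refine ContinuousLinearMap.opNorm_le_bound _ (norm_nonneg _) fun q => ?_
    refine le_of_forall_pos_le_add fun ε hε => ?_
    obtain ⟨x, rfl, hx⟩ := Submodule.Quotient.norm_mk_lt q
      (ε := ε / (‖f‖ + 1)) (by positivity)
    change ‖f x‖ ≤ _
    calc ‖f x‖ ≤ ‖f‖ * ‖x‖ := f.le_opNorm x
      _ ≤ ‖f‖ * (‖(Submodule.Quotient.mk x : E ⧸ S)‖ + ε / (‖f‖ + 1)) := by gcongr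
      _ = ‖f‖ * ‖(Submodule.Quotient.mk x : E ⧸ S)‖ + ‖f‖ / (‖f‖ + 1) * ε := by ring
      _ ≤ ‖f‖ * ‖(Submodule.Quotient.mk x : E ⧸ S)‖ + 1 * ε := by
          gcongr
          rw [div_le_one (by positivity)]
          linarith
      _ = _ := by rw [one_mul]
  · refine ContinuousLinearMap.opNorm_le_bound _ (norm_nonneg _) fun x => ?_
    exact (S.liftQL f h).le_of_opNorm_le_of_le le_rfl (Submodule.Quotient.norm_mk_le S x)

/-- Composition with an isometric isomorphism preserves the norm of a functional. -/
lemma norm_comp_symm_eq {P Q : Type*} [SeminormedAddCommGroup P] [NormedSpace ℂ P]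
    [SeminormedAddCommGroup Q] [NormedSpace ℂ Q] (Ψ : P ≃ₗᵢ[ℂ] Q) (f : StrongDual ℂ P) :
    ‖f.comp (Ψ.symm : Q →L[ℂ] P)‖ = ‖f‖ := by
  refine le_antisymm ?_ ?_
  · refine ContinuousLinearMap.opNorm_le_bound _ (norm_nonneg _) fun q => ?_
    exact f.le_of_opNorm_le_of_le le_rfl (Ψ.symm.norm_map q).le
  · refine ContinuousLinearMap.opNorm_le_bound _ (norm_nonneg _) fun p => ?_
    have h := (f.comp (Ψ.symm : Q →L[ℂ] P)).le_of_opNorm_le_of_le le_rfl (Ψ.norm_map p).le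
    have e : f.comp (Ψ.symm : Q →L[ℂ] P) (Ψ p) = f p := congrArg f (Ψ.symm_apply_apply p)
    rwa [e] at h

/-- If `A` is the dual of `P` and `P` is the dual of `K`, then `A` is the bidual of `K`. -/
lemma exists_bidual_equiv {A P K : Type*} [NormedAddCommGroup A] [NormedSpace ℂ A]
    [SeminormedAddCommGroup P] [NormedSpace ℂ P] [NormedAddCommGroup K] [NormedSpace ℂ K]
    (Φ : A ≃ₗᵢ[ℂ] StrongDual ℂ P) (Ψ : P ≃ₗᵢ[ℂ] StrongDual ℂ K) :
    ∃ Θ : A ≃ₗᵢ[ℂ] StrongDual ℂ (StrongDual ℂ K), ∀ T q, Θ T (Ψ q) = Φ T q := by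
  let Θ₀ : A →ₗᵢ[ℂ] StrongDual ℂ (StrongDual ℂ K) :=
    { toFun := fun T => (Φ T).comp (Ψ.symm : StrongDual ℂ K →L[ℂ] P)
      map_add' := fun S T => by
        rw [map_add, ContinuousLinearMap.add_comp]
      map_smul' := fun c T => by
        rw [map_smul, ContinuousLinearMap.smul_comp]
        rfl
      norm_map' := fun T => (norm_comp_symm_eq Ψ (Φ T)).trans (Φ.norm_map T) }
  have hΘ : ∀ T q, Θ₀ T (Ψ q) = Φ T q := fun T q => by
    change Φ T (Ψ.symm (Ψ q)) = _
    rw [Ψ.symm_apply_apply]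
  refine ⟨LinearIsometryEquiv.ofSurjective Θ₀ fun ξ => ?_, hΘ⟩
  refine ⟨Φ.symm (ξ.comp (Ψ : P →L[ℂ] StrongDual ℂ K)), ?_⟩
  ext ψ
  obtain ⟨q, rfl⟩ := Ψ.surjective ψ
  rw [hΘ, Φ.apply_symm_apply]
  rfl

end Functionals

section Pairing

set_option linter.unusedSectionVars false

variable {H : Type*} [NormedAddCommGroup H] [InnerProductSpace ℂ H] [CompleteSpace H]

lemma hsDual_comm (S y : C₂ H) : hsDual S y = hsDual y S := by
  have hadd : ∀ S S' : C₂ H, hsDual (S + S') y = hsDual S y + hsDual S' y := fun S S' => by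
    simp only [hsDual_apply, map_add, add_mul]
    exact trace_add
      ((traceNorm_mul_le_hsNorm _ _).trans_lt (ENNReal.mul_lt_top
        ((hsExtNorm H).incl_lt_top S) ((hsExtNorm H).incl_lt_top y)))
      ((traceNorm_mul_le_hsNorm _ _).trans_lt (ENNReal.mul_lt_top
        ((hsExtNorm H).incl_lt_top S') ((hsExtNorm H).incl_lt_top y)))
  let φ : StrongDual ℂ (C₂ H) := LinearMap.mkContinuous
    { toFun := fun S => hsDual S y
      map_add' := hadd
      map_smul' := fun c S => by
        simp only [hsDual_apply, map_smul, smul_mul_assoc, trace_smul]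
        rfl } ‖y‖ fun S => by
    rw [mul_comm]
    exact ContinuousLinearMap.le_of_opNorm_le _ (norm_hsDual_le S) y
  have h : φ = hsDual y := C₂.dual_ext fun u v => by
    change trace (rankOne ℂ u v * _) = trace (_ * rankOne ℂ u v)
    exact (trace_mul_comm _ (traceNorm_rankOne_lt_top H u v)).symm
  exact DFunLike.congr_fun h S

/-- The functional `A ↦ Tr (A x)` on the bounded operators, for `x ∈ C₁`. -/
def opDual (x : C₁ H) : StrongDual ℂ (H →L[ℂ] H) :=
  LinearMap.mkContinuous
    { toFun := fun A => traceDual A x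
      map_add' := fun A A' => by
        simp only [traceDual_apply, add_mul]
        exact trace_add
          ((traceNorm_mul_left_le _ _).trans_lt (ENNReal.mul_lt_top enorm_lt_top
            ((traceExtNorm H).incl_lt_top x)))
          ((traceNorm_mul_left_le _ _).trans_lt (ENNReal.mul_lt_top enorm_lt_top
            ((traceExtNorm H).incl_lt_top x)))
      map_smul' := fun c A => by
        simp only [traceDual_apply, smul_mul_assoc, trace_smul]
        rfl } ‖x‖ fun A => by
    rw [mul_comm]
    exact ContinuousLinearMap.le_of_opNorm_le _ (norm_traceDual_le A) x

lemma trace_rankOne_mul (A : H →L[ℂ] H) (u v : H) :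
    trace (rankOne ℂ u v * A) = ⟪v, A u⟫_ℂ := by
  rw [← trace_mul_comm A (traceNorm_rankOne_lt_top H u v), mul_rankOne, trace_rankOne]

lemma opDual_rankOne (x : C₁ H) (u v : H) :
    opDual x (rankOne ℂ u v) = ⟪v, (traceExtNorm H).incl x u⟫_ℂ :=
  trace_rankOne_mul _ u v

lemma comm_rankOne (Z : H →L[ℂ] H) (u v : H) :
    comm Z (rankOne ℂ u v) = rankOne ℂ (Z u) v - rankOne ℂ u (star Z v) := by
  rw [comm, mul_rankOne, rankOne_mul]

lemma op_ext_inner {S T : H →L[ℂ] H} (h : ∀ u v, ⟪v, S u⟫_ℂ = ⟪v, T u⟫_ℂ) : S = T := by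
  ext u
  exact ext_inner_left ℂ (h u)

/-- If the functional `(x, y) ↦ Tr (T x + S y)` on `C₁ × C₂` vanishes on `N`, then `S = [Z, T]`: it
suffices to test it on the pairs `([Z, h], h)` with `h` of rank one. -/
lemma eq_comm_of_vanish {Z T : H →L[ℂ] H} {S : C₂ H}
    (h : ∀ p ∈ nullPairs Z, traceDual T p.1 + hsDual S p.2 = 0) :
    (hsExtNorm H).incl S = comm Z T := by
  refine op_ext_inner fun u v => ?_
  have hmem : (C₁.rankOne (Z u) v - C₁.rankOne u (star Z v), C₂.rankOne u v) ∈ nullPairs Z := by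
    change _ = comm Z (rankOne ℂ u v)
    rw [comm_rankOne, map_sub]
    rfl
  have h1 := h _ hmem
  rw [map_sub, traceDual_rankOne, traceDual_rankOne, hsDual_rankOne,
    ContinuousLinearMap.star_eq_adjoint, ContinuousLinearMap.adjoint_inner_left] at h1
  rw [comm, sub_apply, inner_sub_right, mul_apply_eq_comp, mul_apply_eq_comp]
  linear_combination h1

/-- A pair that annihilates every operator of rank one under `(x, y) ↦ Tr (T x + [Z, T] y)` is of
the form `([Z, y], y)`. -/
lemma mem_nullPairs_of_vanish {Z : H →L[ℂ] H} {x : C₁ H} {y : C₂ H}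
    (h : ∀ u v : H, trace (rankOne ℂ u v * (traceExtNorm H).incl x
      + comm Z (rankOne ℂ u v) * (hsExtNorm H).incl y) = 0) : (x, y) ∈ nullPairs Z := by
  refine op_ext_inner fun u v => ?_
  have hfin : ∀ (u v : H) (A : H →L[ℂ] H), traceNorm (rankOne ℂ u v * A) < ∞ := fun u v A =>
    (traceNorm_mul_right_le _ _).trans_lt
      (ENNReal.mul_lt_top (traceNorm_rankOne_lt_top H u v) enorm_lt_top)
  have h1 := h u v
  rw [comm_rankOne, sub_mul,
    trace_add (hfin _ _ _) (traceNorm_sub_lt_top (hfin _ _ _) (hfin _ _ _)),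
    trace_sub (hfin _ _ _) (hfin _ _ _), trace_rankOne_mul, trace_rankOne_mul, trace_rankOne_mul,
    ContinuousLinearMap.star_eq_adjoint, ContinuousLinearMap.adjoint_inner_left] at h1
  rw [comm, sub_apply, inner_sub_right, mul_apply_eq_comp, mul_apply_eq_comp]
  linear_combination h1

end Pairing

/-! ### The duality between `EΛ(Ω)`, its predual and `KΛ(Ω)` -/

section LambdaDuality

variable {Ω : Set ℂ} (hΩ : MeasurableSet Ω) (hb : Bornology.IsBounded Ω)

/-- An operator with Hilbert–Schmidt commutator `[Z, T]`, as an element of `EΛ(Ω)`. -/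
def ELam.ofComm (T : L2 Ω →L[ℂ] L2 Ω) (hT : hsNorm (comm (opZ hΩ hb) T) < ∞) : ELam Ω :=
  (eLamExtNorm Ω).ofFinite T ((mem_eLam_iff T).2 (by rwa [lipConst_eq hΩ hb]))

/-- The Hilbert–Schmidt operator `[Z, T]`, for `T ∈ EΛ(Ω)`. -/
def commZ (T : ELam Ω) : C₂ (L2 Ω) :=
  (hsExtNorm (L2 Ω)).ofFinite (comm (opZ hΩ hb) T.op) (by
    have h := (mem_eLam_iff T.op).1 T.2
    rwa [lipConst_eq hΩ hb] at h)

lemma incl_commZ (T : ELam Ω) :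
    (hsExtNorm (L2 Ω)).incl (commZ hΩ hb T) = comm (opZ hΩ hb) T.op := rfl

lemma commZ_add (S T : ELam Ω) : commZ hΩ hb (S + T) = commZ hΩ hb S + commZ hΩ hb T := by
  refine (hsExtNorm (L2 Ω)).incl_injective ?_
  simp only [map_add, incl_commZ, comm_add]

lemma commZ_smul (c : ℂ) (T : ELam Ω) : commZ hΩ hb (c • T) = c • commZ hΩ hb T := by
  refine (hsExtNorm (L2 Ω)).incl_injective ?_
  simp only [map_smul, incl_commZ, comm_smul]

lemma ELam.norm_eq (T : ELam Ω) : ‖T‖ = ‖T.op‖ + ‖commZ hΩ hb T‖ := by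
  have h : ‖T‖ₑ = ‖T.op‖ₑ + ‖commZ hΩ hb T‖ₑ := by
    rw [(eLamExtNorm Ω).enorm_def, (hsExtNorm (L2 Ω)).enorm_def]
    change _ + lipConst T.op = _
    rw [lipConst_eq hΩ hb]
    rfl
  rw [← ofReal_norm, ← ofReal_norm, ← ofReal_norm,
    ← ENNReal.ofReal_add (norm_nonneg _) (norm_nonneg _)] at h
  exact (ENNReal.ofReal_eq_ofReal_iff (norm_nonneg _) (by positivity)).1 h

lemma traceNorm_op_mul_lt_top (T : ELam Ω) (x : C₁ (L2 Ω)) :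
    traceNorm (T.op * (traceExtNorm (L2 Ω)).incl x) < ∞ :=
  (traceNorm_mul_left_le _ _).trans_lt (ENNReal.mul_lt_top enorm_lt_top
    ((traceExtNorm (L2 Ω)).incl_lt_top x))

lemma traceNorm_commZ_mul_lt_top (T : ELam Ω) (y : C₂ (L2 Ω)) :
    traceNorm (comm (opZ hΩ hb) T.op * (hsExtNorm (L2 Ω)).incl y) < ∞ :=
  (traceNorm_mul_le_hsNorm _ _).trans_lt (ENNReal.mul_lt_top
    ((hsExtNorm (L2 Ω)).incl_lt_top (commZ hΩ hb T)) ((hsExtNorm (L2 Ω)).incl_lt_top y))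

lemma traceNorm_pairOp_lt_top (T : ELam Ω) (x : C₁ (L2 Ω)) (y : C₂ (L2 Ω)) :
    traceNorm (pairOp hΩ hb T x y) < ∞ :=
  (traceNorm_add_le _ _).trans_lt (ENNReal.add_lt_top.2
    ⟨traceNorm_op_mul_lt_top T x, traceNorm_commZ_mul_lt_top hΩ hb T y⟩)

/-- The functional `(x, y) ↦ Tr (T x + [Z, T] y)` on `C₁ × C₂`. -/
def pairDual (T : ELam Ω) : StrongDual ℂ (C₁ (L2 Ω) × C₂ (L2 Ω)) :=
  (traceDual T.op).coprod (hsDual (commZ hΩ hb T))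

lemma pairDual_apply (T : ELam Ω) (x : C₁ (L2 Ω)) (y : C₂ (L2 Ω)) :
    pairDual hΩ hb T (x, y) = trace (pairOp hΩ hb T x y) :=
  (trace_add (traceNorm_op_mul_lt_top T x) (traceNorm_commZ_mul_lt_top hΩ hb T y)).symm

/-- On the pairs `([Z, h], h)`, the pairing is the trace of the commutator `[Z, T h]`. -/
lemma nullPairs_le_ker (T : ELam Ω) : nullPairs (opZ hΩ hb) ≤ (pairDual hΩ hb T).ker := by
  rintro ⟨x, y⟩ hp
  change (traceExtNorm (L2 Ω)).incl x = comm (opZ hΩ hb) ((hsExtNorm (L2 Ω)).incl y) at hp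
  change pairDual hΩ hb T (x, y) = 0
  have hfin := traceNorm_pairOp_lt_top hΩ hb T x y
  have e : pairOp hΩ hb T x y = comm (opZ hΩ hb) (T.op * (hsExtNorm (L2 Ω)).incl y) := by
    rw [pairOp, hp, comm_mul, add_comm]
  rw [pairDual_apply]
  rw [e] at hfin ⊢
  exact trace_comm_opZ_eq_zero hΩ hb ((hsNorm_mul_left_le _ _).trans_lt
    (ENNReal.mul_lt_top enorm_lt_top ((hsExtNorm (L2 Ω)).incl_lt_top y))) hfin

/-- The map of `EΛ(Ω)` to the dual of `(C₁ × C₂) / N`, as a linear isometry. -/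
def eLamToDual : ELam Ω →ₗᵢ[ℂ] StrongDual ℂ (Predual hΩ hb) where
  toFun T := (nullPairs (opZ hΩ hb)).liftQL (pairDual hΩ hb T) (nullPairs_le_ker hΩ hb T)
  map_add' S T := by
    ext q
    obtain ⟨⟨x, y⟩, rfl⟩ := Submodule.Quotient.mk_surjective _ q
    change pairDual hΩ hb (S + T) (x, y) = pairDual hΩ hb S (x, y) + pairDual hΩ hb T (x, y)
    change opDual x (S + T).op + hsDual (commZ hΩ hb (S + T)) y
      = (opDual x S.op + hsDual (commZ hΩ hb S) y) + (opDual x T.op + hsDual (commZ hΩ hb T) y)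
    rw [commZ_add, hsDual_comm (_ + _), hsDual_comm (commZ hΩ hb S), hsDual_comm (commZ hΩ hb T)]
    simp only [map_add]
    ring
  map_smul' c T := by
    ext q
    obtain ⟨⟨x, y⟩, rfl⟩ := Submodule.Quotient.mk_surjective _ q
    change opDual x (c • T).op + hsDual (commZ hΩ hb (c • T)) y
      = c * (opDual x T.op + hsDual (commZ hΩ hb T) y)
    rw [commZ_smul, hsDual_comm (_ • _), hsDual_comm (commZ hΩ hb T)]
    simp only [map_smul, smul_eq_mul]
    ring
  norm_map' T := by
    change ‖(nullPairs (opZ hΩ hb)).liftQL (pairDual hΩ hb T) (nullPairs_le_ker hΩ hb T)‖ = _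
    rw [norm_liftQL, pairDual, norm_coprod_eq_add, norm_traceDual, norm_hsDual,
      ELam.norm_eq hΩ hb]

lemma eLamToDual_cls (T : ELam Ω) (x : C₁ (L2 Ω)) (y : C₂ (L2 Ω)) :
    eLamToDual hΩ hb T (cls hΩ hb x y) = trace (pairOp hΩ hb T x y) :=
  pairDual_apply hΩ hb T x y

lemma eLamToDual_surjective : Function.Surjective (eLamToDual hΩ hb) := by
  intro φ
  let f : StrongDual ℂ (C₁ (L2 Ω) × C₂ (L2 Ω)) := φ.comp (nullPairs (opZ hΩ hb)).mkQL
  obtain ⟨T, hT⟩ := exists_traceDual_eq (f.comp (ContinuousLinearMap.inl ℂ _ _))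
  obtain ⟨S, hS⟩ := exists_hsDual_eq (f.comp (ContinuousLinearMap.inr ℂ _ _))
  have hf : ∀ p, f p = traceDual T p.1 + hsDual S p.2 := fun p => by
    rw [hT, hS]
    change f p = f (p.1, 0) + f (0, p.2)
    rw [← map_add, Prod.mk_add_mk, add_zero, zero_add]
  have hST : (hsExtNorm (L2 Ω)).incl S = comm (opZ hΩ hb) T :=
    eq_comm_of_vanish fun p hp => by
      rw [← hf]
      change φ (Submodule.Quotient.mk p) = 0
      rw [(Submodule.Quotient.mk_eq_zero _).2 hp, map_zero]
  have hfin : hsNorm (comm (opZ hΩ hb) T) < ∞ := by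
    rw [← hST]
    exact (hsExtNorm (L2 Ω)).incl_lt_top S
  refine ⟨ELam.ofComm hΩ hb T hfin, ?_⟩
  have hSc : S = commZ hΩ hb (ELam.ofComm hΩ hb T hfin) :=
    (hsExtNorm (L2 Ω)).incl_injective hST
  ext q
  obtain ⟨p, rfl⟩ := Submodule.Quotient.mk_surjective _ q
  change traceDual T p.1 + hsDual (commZ hΩ hb (ELam.ofComm hΩ hb T hfin)) p.2 = f p
  rw [← hSc, hf]

/-- The map of `(C₁ × C₂) / N` to the dual of `KΛ(Ω)`. -/
def predualToDual : Predual hΩ hb →ₗ[ℂ] StrongDual ℂ (KLam Ω) where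
  toFun q := ((ContinuousLinearMap.apply ℂ ℂ q).comp
    (eLamToDual hΩ hb).toContinuousLinearMap).comp (KLam Ω).subtypeL
  map_add' p q := by
    ext K
    exact map_add (eLamToDual hΩ hb K) p q
  map_smul' c q := by
    ext K
    exact map_smul (eLamToDual hΩ hb K) c q

lemma predualToDual_apply (q : Predual hΩ hb) (K : KLam Ω) :
    predualToDual hΩ hb q K = eLamToDual hΩ hb K q := rfl

lemma norm_predualToDual_le (q : Predual hΩ hb) : ‖predualToDual hΩ hb q‖ ≤ ‖q‖ := by
  refine ContinuousLinearMap.opNorm_le_bound _ (norm_nonneg _) fun K => ?_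
  rw [predualToDual_apply, mul_comm]
  refine ContinuousLinearMap.le_of_opNorm_le _ ?_ q
  rw [LinearIsometry.norm_map]
  rfl

lemma predualToDual_injective : Function.Injective (predualToDual hΩ hb) := by
  rw [← LinearMap.ker_eq_bot, LinearMap.ker_eq_bot']
  intro q hq
  obtain ⟨⟨x, y⟩, rfl⟩ := Submodule.Quotient.mk_surjective _ q
  refine (Submodule.Quotient.mk_eq_zero _).2 (mem_nullPairs_of_vanish fun u v => ?_)
  have hfin : hsNorm (comm (opZ hΩ hb) (rankOne ℂ u v)) < ∞ := by
    refine (hsNorm_comm_le _ _).trans_lt (ENNReal.mul_lt_top ?_ (hsNorm_rankOne_lt_top u v))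
    exact ENNReal.mul_lt_top ENNReal.ofNat_lt_top enorm_lt_top
  let K : KLam Ω := ⟨ELam.ofComm hΩ hb (rankOne ℂ u v) hfin, by
    exact (isCompactOperator_of_locallyCompactSpace_rng
      (ContinuousLinearMap.toSpanSingleton ℂ u)).comp_clm (innerSL ℂ v)⟩
  have h := DFunLike.congr_fun hq K
  rw [predualToDual_apply] at h
  exact (eLamToDual_cls hΩ hb K x y).symm.trans h

/-- The isometric embedding `T ↦ (T, [Z, T])` of `KΛ(Ω)` into `B × C₂` with the sum of the norms. -/
def kLamEmbed : KLam Ω →ₗᵢ[ℂ] WithLp 1 ((L2 Ω →L[ℂ] L2 Ω) × C₂ (L2 Ω)) where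
  toFun K := WithLp.toLp 1 ((K : ELam Ω).op, commZ hΩ hb K)
  map_add' K K' := by
    rw [Submodule.coe_add, commZ_add, ELam.op, map_add]
    rfl
  map_smul' c K := by
    rw [Submodule.coe_smul, commZ_smul, ELam.op, map_smul]
    rfl
  norm_map' K := by
    rw [WithLp.prod_norm_eq_of_L1]
    exact (ELam.norm_eq hΩ hb K).symm

/-- Every functional on `KΛ(Ω)` comes from a pair of at most the same norm: extend it from the
range of `T ↦ (T, [Z, T])` to `B × C₂` by the Hahn–Banach theorem. -/
lemma exists_predualToDual_eq (ψ : StrongDual ℂ (KLam Ω)) :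
    ∃ q, predualToDual hΩ hb q = ψ ∧ ‖q‖ ≤ ‖ψ‖ := by
  let J := kLamEmbed hΩ hb
  obtain ⟨g, hg, hgn⟩ := exists_extension_norm_eq (LinearMap.range J.toLinearMap)
    (ψ.comp (J.equivRange.symm : LinearMap.range J.toLinearMap ≃L[ℂ] KLam Ω).toContinuousLinearMap)
  have hgψ : ∀ K, g (J K) = ψ K := fun K => by
    have h := hg (J.equivRange K)
    simpa using h
  have hgn' : ‖g‖ ≤ ‖ψ‖ := by
    rw [hgn]
    refine ContinuousLinearMap.opNorm_le_bound _ (norm_nonneg _) fun p => ?_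
    refine ψ.le_of_opNorm_le_of_le le_rfl ?_
    exact (J.equivRange.symm.norm_map p).le
  let e := (WithLp.prodContinuousLinearEquiv 1 ℂ (L2 Ω →L[ℂ] L2 Ω) (C₂ (L2 Ω))).symm
  let g' : StrongDual ℂ ((L2 Ω →L[ℂ] L2 Ω) × C₂ (L2 Ω)) := g.comp e.toContinuousLinearMap
  let g₁ := g'.comp (ContinuousLinearMap.inl ℂ _ _)
  let g₂ := g'.comp (ContinuousLinearMap.inr ℂ _ _)
  have hg₁ : ‖g₁‖ ≤ ‖ψ‖ := by
    refine ContinuousLinearMap.opNorm_le_bound _ (norm_nonneg _) fun A => ?_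
    refine g.le_of_opNorm_le_of_le hgn' ?_
    rw [WithLp.prod_norm_eq_of_L1]
    simp [e]
  have hg₂ : ‖g₂‖ ≤ ‖ψ‖ := by
    refine ContinuousLinearMap.opNorm_le_bound _ (norm_nonneg _) fun S => ?_
    refine g.le_of_opNorm_le_of_le hgn' ?_
    rw [WithLp.prod_norm_eq_of_L1]
    simp [e]
  obtain ⟨X, hX⟩ := exists_op_of_linear g₁ (fun u v => rankOne ℂ u v)
    (fun u u' v => by simp) (fun u v v' => by simp) (fun c u v => by simp)
    (fun c u v => by simp) (fun u v => (InnerProductSpace.enorm_rankOne u v).le)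
  have hXn := traceNorm_le_of_dual_rankOne hX
  let x : C₁ (L2 Ω) := (traceExtNorm (L2 Ω)).ofFinite X (hXn.trans_lt enorm_lt_top)
  obtain ⟨y, hy⟩ := exists_hsDual_eq g₂
  have hx : ‖x‖ ≤ ‖ψ‖ := by
    refine le_trans ?_ hg₁
    have h : ‖x‖ₑ ≤ ‖g₁‖ₑ := by
      rw [(traceExtNorm (L2 Ω)).enorm_def]
      exact hXn
    rw [← ofReal_norm, ← ofReal_norm] at h
    exact (ENNReal.ofReal_le_ofReal_iff (norm_nonneg _)).1 h
  have hyn : ‖y‖ ≤ ‖ψ‖ := by rwa [← norm_hsDual, hy]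
  refine ⟨cls hΩ hb x y, ?_, (Submodule.Quotient.norm_mk_le _ _).trans (max_le hx hyn)⟩
  ext K
  have h₁ : opDual x (K : ELam Ω).op = g₁ (K : ELam Ω).op :=
    dual_apply_eq_of_isCompactOperator (fun u v => by rw [opDual_rankOne, hX]; rfl) K.2
  have h₂ : hsDual (commZ hΩ hb K) y = g₂ (commZ hΩ hb K) := by rw [hsDual_comm, hy]
  change opDual x (K : ELam Ω).op + hsDual (commZ hΩ hb K) y = ψ K
  rw [h₁, h₂, ← hgψ]
  change g' ((K : ELam Ω).op, 0) + g' (0, commZ hΩ hb K) = g' ((K : ELam Ω).op, commZ hΩ hb K)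
  rw [← map_add, Prod.mk_add_mk, add_zero, zero_add]

lemma norm_predualToDual (q : Predual hΩ hb) : ‖predualToDual hΩ hb q‖ = ‖q‖ := by
  refine (norm_predualToDual_le hΩ hb q).antisymm ?_
  obtain ⟨q', hq', hle⟩ := exists_predualToDual_eq hΩ hb (predualToDual hΩ hb q)
  rwa [predualToDual_injective hΩ hb hq'] at hle

end LambdaDuality

end AlmostNormal
end

theorem mainTheorem5 (Ω : Set ℂ) (hΩ : MeasurableSet Ω) (hb : Bornology.IsBounded Ω) :
    ∃ (Φ : ELam Ω ≃ₗᵢ[ℂ] StrongDual ℂ (Predual hΩ hb))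
      (Ψ : Predual hΩ hb ≃ₗᵢ[ℂ] StrongDual ℂ (KLam Ω))
      (Θ : ELam Ω ≃ₗᵢ[ℂ] StrongDual ℂ (StrongDual ℂ (KLam Ω))),
      (∀ (T : ELam Ω) (x : C₁ (L2 Ω)) (y : C₂ (L2 Ω)),
        traceNorm (pairOp hΩ hb T x y) < ∞ ∧
        Φ T (cls hΩ hb x y) = trace (pairOp hΩ hb T x y)) ∧
      (∀ (K : KLam Ω) (x : C₁ (L2 Ω)) (y : C₂ (L2 Ω)),
        Ψ (cls hΩ hb x y) K = trace (pairOp hΩ hb K x y)) ∧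
      (∀ (T : ELam Ω) (q : Predual hΩ hb), Θ T (Ψ q) = Φ T q) ∧
      (∀ K : KLam Ω, Θ K = NormedSpace.inclusionInDoubleDual ℂ (KLam Ω) K) := by
  let Φ := LinearIsometryEquiv.ofSurjective (eLamToDual hΩ hb) (eLamToDual_surjective hΩ hb)
  let Ψ : Predual hΩ hb ≃ₗᵢ[ℂ] StrongDual ℂ (KLam Ω) :=
    { LinearEquiv.ofBijective (predualToDual hΩ hb) ⟨predualToDual_injective hΩ hb, fun ψ =>
        let ⟨q, hq, _⟩ := exists_predualToDual_eq hΩ hb ψ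
        ⟨q, hq⟩⟩ with
      norm_map' := norm_predualToDual hΩ hb }
  obtain ⟨Θ, hΘ⟩ := exists_bidual_equiv Φ Ψ
  refine ⟨Φ, Ψ, Θ, fun T x y =>
    ⟨traceNorm_pairOp_lt_top hΩ hb T x y, eLamToDual_cls hΩ hb T x y⟩,
    fun K x y => eLamToDual_cls hΩ hb K x y, hΘ, fun K => ?_⟩
  ext ψ
  obtain ⟨q, rfl⟩ := Ψ.surjective ψ
  exact hΘ K q
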